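/- Let $a=(a_{ij})_{0\le i,j\le 2}$ be a complex matrix, let $Q(x,y)=\sum_{i,j=0}^{2}a_{ij}x^iy^j$, and let $\mathcal C\subset\mathbb P^1(\mathbb C)\times\mathbb P^1(\mathbb C)$ be the biquadratic curve $$\sum_{i,j=0}^{2}a_{ij}\,x_1^i x_0^{2-i}\,y_1^j y_0^{2-j}=0 ,\qquad x=x_1/x_0,\ y=y_1/y_0 .$$ For a quartic $P=p_4t^4+4p_3t^3+6p_2t^2+4p_1t+p_0$ put $D(P)=p_0p_4+3p_2^2-4p_1p_3$ and $E(P)=p_0p_3^2+p_1^2p_4-p_0p_2p_4-2p_1p_2p_3+p_2^3$. Let $D_{\mathcal C}$, $E_{\mathcal C}$ be the values of $D$, $E$ at the discriminant of $Q$ with respect to $y$ (a polynomial in $x$ of degree at most four); the discriminant of $Q$ with respect to $x$ gives the same values. Put $F_{\mathcal C}=256(D_{\mathcal C}^3-27E_{\mathcal C}^2)$ and $$X=\tfrac1{12}\bigl(a_{11}^2-4a_{12}a_{10}-4a_{21}a_{01}+8a_{02}a_{20}+8a_{22}a_{00}\bigr),\qquad Y=\det(a_{ij}).$$ The point $(X,Y)$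 lies on the cubic $y^2=4x^3-D_{\mathcal C}x+E_{\mathcal C}$. The horizontal switch $h:(x,y)\mapsto(x',y)$ and the vertical switch $v:(x,y)\mapsto(x,y')$ are the involutions of $\mathcal C$ for which $x,x'$ are the two solutions (with multiplicity, in $\mathbb P^1$) of $Q(\cdot,y)=0$ and $y,y'$ the two solutions of $Q(x,\cdot)=0$. The group of random walk $\mathcal H(\mathcal C)$ is the group of transformations of $\mathcal C$ generated by $h$ and $v$. If $Y\ne0$, let $C_0,C_1,C_2,\dots$ be the coefficients of the Taylor expansion $$\sqrt{4x^3-D_{\mathcal C}x+E_{\mathcal C}}=C_0+C_1(x-X)+C_2(x-X)^2+\cdots$$ about $x=X$ of the branch of the square root that takes the value $Y$ at $X$. Assume $F_{\mathcal C}\neq0$ (equivalently, $\mathcal C$ is smooth). Then: 1. $|\mathcal H(\mathcal C)|=4$ if and only if $\det(a_{ij})=0$; 2. $|\mathcal H(\mathcal C)|=6$ if and only if $\det(a_{ij})\ne0$ and $C_2=0$; 3. $|\mathcal H(\mathcal C)|=8$ if and only if $\det(a_{ij})\ne0$ and $C_3=0$; 4. $|\mathcal H(\mathcal C)|=10$ if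 and only if $\det(a_{ij})\ne0$ and $C_3^2=C_2C_4$; 5. $|\mathcal H(\mathcal C)|=12$ if and only if $\det(a_{ij})\ne0$, $C_4^2=C_3C_5$ and $C_2\ne0$. Moreover, if $\det(a_{ij})\neq0$, then, writing $D=D_{\mathcal C}$, $E=E_{\mathcal C}$ and $S=\sqrt{4X^3-DX+E}=\det(a_{ij})$ for the value at $X$ of the chosen branch, $$C_2=\frac{-D^2-24DX^2+48EX+48X^4}{8S^3},$$ $$C_3=\frac{-D^3+20D^2X^2-16DEX+80DX^4+32E^2-320EX^3-64X^6}{16S^5},$$ $$C_4=\frac{-5D^4+80D^3X^2+32D^2EX-1120D^2X^4+128DE^2+1792DEX^3-1792DX^6-3840E^2X^2+10752EX^5+768X^8}{128S^7},$$ $$C_5=\frac{1}{256S^9}\Bigl(-7D^5+132D^4X^2+96D^3X(E-9X^3)+192D^2(E^2-10EX^3+70X^6)-2304DX^2(E^2+14EX^3-5X^6)-3072X(E^3-24E^2X^3+30EX^6+X^9)\Bigr).$$ -/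

import Mathlib

namespace Biquadratic

/-- The complex projective line, with homogeneous coordinates `[u 0 : u 1]`; the point of the affine
line with coordinate `x` is `[1 : x]`. -/
abbrev P1 : Type := Projectivization ℂ (Fin 2 → ℂ)

/-- The bihomogeneous form `∑ a i j * x₁ ^ i * x₀ ^ (2 - i) * y₁ ^ j * y₀ ^ (2 - j)`, the
homogenization of the biquadratic polynomial `Q(x, y) = ∑ a i j * x ^ i * y ^ j`. -/
def form (a : Matrix (Fin 3) (Fin 3) ℂ) (x y : Fin 2 → ℂ) : ℂ :=
  ∑ i : Fin 3, ∑ j : Fin 3,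
    a i j * x 1 ^ (i : ℕ) * x 0 ^ (2 - (i : ℕ)) * y 1 ^ (j : ℕ) * y 0 ^ (2 - (j : ℕ))

/-- The biquadratic curve in `P1 × P1`. -/
def curve (a : Matrix (Fin 3) (Fin 3) ℂ) : Set (P1 × P1) :=
  {p | form a p.1.rep p.2.rep = 0}

theorem form_smul (a : Matrix (Fin 3) (Fin 3) ℂ) (r s : ℂ) (x y : Fin 2 → ℂ) :
    form a (r • x) (s • y) = r ^ 2 * s ^ 2 * form a x y := by
  simp only [form, Fin.sum_univ_three, Pi.smul_apply, smul_eq_mul]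
  simp
  ring

/-- Membership in the curve can be tested on any homogeneous coordinates. -/
theorem mk_mem_curve (a : Matrix (Fin 3) (Fin 3) ℂ) (x y : Fin 2 → ℂ) (hx : x ≠ 0) (hy : y ≠ 0) :
    (Projectivization.mk ℂ x hx, Projectivization.mk ℂ y hy) ∈ curve a ↔ form a x y = 0 := by
  obtain ⟨r, hr⟩ := Projectivization.exists_smul_eq_mk_rep ℂ x hx
  obtain ⟨s, hs⟩ := Projectivization.exists_smul_eq_mk_rep ℂ y hy
  simp only [curve, Set.mem_ofPred_eq, ← hr, ← hs, Units.smul_def, form_smul]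
  simp

/-- The determinant of two vectors; as a function of `u` it is the linear form with zero `[v]`. -/
def bracket (u v : Fin 2 → ℂ) : ℂ := u 0 * v 1 - u 1 * v 0

/-- `P` and `P'` are the two zeros, counted with multiplicity, of the nonzero binary quadratic
form `q`. -/
def IsRootPair (q : (Fin 2 → ℂ) → ℂ) (P P' : P1) : Prop :=
  ∃ c : ℂ, c ≠ 0 ∧ ∀ u : Fin 2 → ℂ, q u = c * bracket u P.rep * bracket u P'.rep

open Classical in
/-- The second zero of the binary quadratic form `q`, given one zero `P` of it. (If `q` vanishes
identically, which happens for no fibre of a smooth curve, the value is `P`.) -/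
noncomputable def otherRoot (q : (Fin 2 → ℂ) → ℂ) (P : P1) : P1 :=
  if h : ∃ P', IsRootPair q P P' then h.choose else P

theorem eq_of_bracket {P P' : P1} (h : bracket P.rep P'.rep = 0) : P = P' := by
  have hP := P.rep_nonzero
  have hP' := P'.rep_nonzero
  rw [← P.mk_rep, ← P'.mk_rep, Projectivization.mk_eq_mk_iff']
  unfold bracket at h
  generalize P.rep = u at *
  generalize P'.rep = v at *
  by_cases h0 : v 0 = 0
  · have h1 : v 1 ≠ 0 := by
      intro h1
      apply hP'
      ext i
      fin_cases i <;> simp [h0, h1]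
    refine ⟨u 1 / v 1, ?_⟩
    ext i
    fin_cases i
    · simp [h0] at h ⊢
      tauto
    · simp [h1]
  · refine ⟨u 0 / v 0, ?_⟩
    ext i
    fin_cases i
    · simp [h0]
    · simp
      field_simp
      linear_combination h

theorem bracket_self (u : Fin 2 → ℂ) : bracket u u = 0 := by
  unfold bracket; ring

theorem IsRootPair.symm {q : (Fin 2 → ℂ) → ℂ} {P P' : P1} (h : IsRootPair q P P') :
    IsRootPair q P' P := by
  obtain ⟨c, hc, h⟩ := h
  exact ⟨c, hc, fun u => by rw [h u]; ring⟩

theorem IsRootPair.unique {q : (Fin 2 → ℂ) → ℂ} {P P₁ P₂ : P1} (h₁ : IsRootPair q P P₁)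
    (h₂ : IsRootPair q P P₂) : P₁ = P₂ := by
  obtain ⟨c₁, hc₁, h₁⟩ := h₁
  obtain ⟨c₂, hc₂, h₂⟩ := h₂
  have e₁ := (h₁ P₁.rep).symm.trans (h₂ P₁.rep)
  have e₂ := (h₁ P₂.rep).symm.trans (h₂ P₂.rep)
  rw [bracket_self, mul_zero] at e₁ e₂
  by_cases k₁ : bracket P₁.rep P.rep = 0
  · by_cases k₂ : bracket P₂.rep P.rep = 0
    · exact (eq_of_bracket k₁).trans (eq_of_bracket k₂).symm
    · refine (eq_of_bracket ?_).symm
      simpa [hc₁, k₂] using e₂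
  · refine eq_of_bracket ?_
    simpa [hc₂, k₁] using e₁.symm

theorem otherRoot_eq {q : (Fin 2 → ℂ) → ℂ} {P P' : P1} (h : IsRootPair q P P') :
    otherRoot q P = P' := by
  have h' : ∃ P', IsRootPair q P P' := ⟨P', h⟩
  rw [otherRoot, dif_pos h']
  exact h'.choose_spec.unique h

/-- A zero of a nonzero binary quadratic form always has a partner. -/
theorem exists_isRootPair {q : (Fin 2 → ℂ) → ℂ} {A B C : ℂ}
    (hq : ∀ u, q u = A * u 1 ^ 2 + B * u 1 * u 0 + C * u 0 ^ 2) (h0 : ∃ u, q u ≠ 0) {P : P1}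
    (hP : q P.rep = 0) : ∃ P', IsRootPair q P P' := by
  have key : ∃ w : Fin 2 → ℂ, ∃ d : ℂ, d ≠ 0 ∧ ∀ u, q u = d * bracket u P.rep * bracket u w := by
    have hn := P.rep_nonzero
    rw [hq] at hP
    unfold bracket
    generalize P.rep = v at *
    by_cases hv : v 0 = 0
    · have h1 : v 1 ≠ 0 := by
        intro h1
        apply hn
        ext i
        fin_cases i <;> simp [hv, h1]
      have hA : A = 0 := by simpa [hv, h1] using hP
      refine ⟨![-B, C], (v 1)⁻¹, inv_ne_zero h1, fun u => ?_⟩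
      rw [hq, hv, hA]
      simp
      field_simp
      ring
    · refine ⟨![A * v 0, -(B * v 0 + A * v 1)], (v 0 ^ 2)⁻¹, inv_ne_zero (pow_ne_zero _ hv),
        fun u => ?_⟩
      rw [hq]
      simp
      field_simp
      linear_combination u 0 ^ 2 * hP
  obtain ⟨w, d, hd, hw⟩ := key
  have hw0 : w ≠ 0 := by
    rintro rfl
    obtain ⟨u, hu⟩ := h0
    exact hu (by rw [hw]; simp [bracket])
  obtain ⟨r, hr⟩ := Projectivization.exists_smul_eq_mk_rep ℂ w hw0
  refine ⟨Projectivization.mk ℂ w hw0, d * (r : ℂ)⁻¹, mul_ne_zero hd (inv_ne_zero r.ne_zero),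
    fun u => ?_⟩
  rw [hw, ← hr, Units.smul_def]
  have := r.ne_zero
  simp only [bracket, Pi.smul_apply, smul_eq_mul]
  field_simp

theorem otherRoot_zero {q : (Fin 2 → ℂ) → ℂ} {P : P1} (h : q P.rep = 0) :
    q (otherRoot q P).rep = 0 := by
  by_cases h' : ∃ P', IsRootPair q P P'
  · obtain ⟨P', h'⟩ := h'
    rw [otherRoot_eq h']
    obtain ⟨c, -, h'⟩ := h'
    rw [h', bracket_self, mul_zero]
  · rwa [otherRoot, dif_neg h']

theorem otherRoot_otherRoot (q : (Fin 2 → ℂ) → ℂ) (P : P1) :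
    otherRoot q (otherRoot q P) = P := by
  by_cases h' : ∃ P', IsRootPair q P P'
  · obtain ⟨P', h'⟩ := h'
    rw [otherRoot_eq h', otherRoot_eq h'.symm]
  · have : otherRoot q P = P := by rw [otherRoot, dif_neg h']
    rw [this, this]

/-- The horizontal switch `(x, y) ↦ (x', y)`, where `x`, `x'` are the two solutions of
`Q(·, y) = 0`. -/
noncomputable def horizontalSwitch (a : Matrix (Fin 3) (Fin 3) ℂ) : Equiv.Perm (curve a) :=
  Function.Involutive.toPerm
    (fun p => ⟨(otherRoot (fun u => form a u p.1.2.rep) p.1.1, p.1.2),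
      otherRoot_zero (q := fun u => form a u p.1.2.rep) p.2⟩)
    (fun _ => Subtype.ext (Prod.ext (otherRoot_otherRoot _ _) rfl))

/-- The vertical switch `(x, y) ↦ (x, y')`, where `y`, `y'` are the two solutions of
`Q(x, ·) = 0`. -/
noncomputable def verticalSwitch (a : Matrix (Fin 3) (Fin 3) ℂ) : Equiv.Perm (curve a) :=
  Function.Involutive.toPerm
    (fun p => ⟨(p.1.1, otherRoot (fun u => form a p.1.1.rep u) p.1.2),
      otherRoot_zero (q := fun u => form a p.1.1.rep u) p.2⟩)
    (fun _ => Subtype.ext (Prod.ext rfl (otherRoot_otherRoot _ _)))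

/-- The group of random walk: the group of transformations of the curve generated by the two
switches. Its order is its `Nat.card`, which is `0` when the group is infinite. -/
def walkGroup (a : Matrix (Fin 3) (Fin 3) ℂ) : Subgroup (Equiv.Perm (curve a)) :=
  Subgroup.closure {horizontalSwitch a, verticalSwitch a}

/-- The coefficient of `y ^ j` in `Q`, a polynomial in `x`. -/
noncomputable def coeffY (a : Matrix (Fin 3) (Fin 3) ℂ) (j : Fin 3) : Polynomial ℂ :=
  ∑ i : Fin 3, Polynomial.C (a i j) * Polynomial.X ^ (i : ℕ)

/-- The coefficient of `x ^ i` in `Q`, a polynomial in `y`. -/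
noncomputable def coeffX (a : Matrix (Fin 3) (Fin 3) ℂ) (i : Fin 3) : Polynomial ℂ :=
  ∑ j : Fin 3, Polynomial.C (a i j) * Polynomial.X ^ (j : ℕ)

/-- The discriminant of `Q` as a quadratic polynomial in `y`. -/
noncomputable def discrY (a : Matrix (Fin 3) (Fin 3) ℂ) : Polynomial ℂ :=
  coeffY a 1 ^ 2 - 4 * coeffY a 2 * coeffY a 0

/-- The discriminant of `Q` as a quadratic polynomial in `x`. -/
noncomputable def discrX (a : Matrix (Fin 3) (Fin 3) ℂ) : Polynomial ℂ :=
  coeffX a 1 ^ 2 - 4 * coeffX a 2 * coeffX a 0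

/-- The Eisenstein invariant `D = a₀ a₄ + 3 a₂² - 4 a₁ a₃` of
`a₄ x⁴ + 4 a₃ x³ + 6 a₂ x² + 4 a₁ x + a₀`. -/
noncomputable def eisensteinD (p : Polynomial ℂ) : ℂ :=
  p.coeff 0 * p.coeff 4 + 3 * (p.coeff 2 / 6) ^ 2 - 4 * (p.coeff 1 / 4) * (p.coeff 3 / 4)

/-- The Eisenstein invariant `E = a₀ a₃² + a₁² a₄ - a₀ a₂ a₄ - 2 a₁ a₂ a₃ + a₂³` of
`a₄ x⁴ + 4 a₃ x³ + 6 a₂ x² + 4 a₁ x + a₀`. -/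
noncomputable def eisensteinE (p : Polynomial ℂ) : ℂ :=
  p.coeff 0 * (p.coeff 3 / 4) ^ 2 + (p.coeff 1 / 4) ^ 2 * p.coeff 4
    - p.coeff 0 * (p.coeff 2 / 6) * p.coeff 4
    - 2 * (p.coeff 1 / 4) * (p.coeff 2 / 6) * (p.coeff 3 / 4) + (p.coeff 2 / 6) ^ 3

/-- The projective invariant `D` of the biquadratic curve. -/
noncomputable def invD (a : Matrix (Fin 3) (Fin 3) ℂ) : ℂ := eisensteinD (discrY a)

/-- The projective invariant `E` of the biquadratic curve. -/
noncomputable def invE (a : Matrix (Fin 3) (Fin 3) ℂ) : ℂ := eisensteinE (discrY a)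

/-- The discriminant `F = 256 (D³ - 27 E²)` of the biquadratic curve. -/
noncomputable def invF (a : Matrix (Fin 3) (Fin 3) ℂ) : ℂ := 256 * (invD a ^ 3 - 27 * invE a ^ 2)

theorem coeff_quartic (b₀ b₁ b₂ c₀ c₁ c₂ d₀ d₁ d₂ : ℂ) (p : Polynomial ℂ)
    (hp : p = (Polynomial.C b₀ + Polynomial.C b₁ * Polynomial.X
        + Polynomial.C b₂ * Polynomial.X ^ 2) ^ 2
      - 4 * (Polynomial.C c₀ + Polynomial.C c₁ * Polynomial.X
        + Polynomial.C c₂ * Polynomial.X ^ 2)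
      * (Polynomial.C d₀ + Polynomial.C d₁ * Polynomial.X
        + Polynomial.C d₂ * Polynomial.X ^ 2)) :
    p.coeff 0 = b₀ ^ 2 - 4 * c₀ * d₀ ∧
    p.coeff 1 = 2 * b₀ * b₁ - 4 * (c₀ * d₁ + c₁ * d₀) ∧
    p.coeff 2 = b₁ ^ 2 + 2 * b₀ * b₂ - 4 * (c₀ * d₂ + c₁ * d₁ + c₂ * d₀) ∧
    p.coeff 3 = 2 * b₁ * b₂ - 4 * (c₁ * d₂ + c₂ * d₁) ∧
    p.coeff 4 = b₂ ^ 2 - 4 * c₂ * d₂ := by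
  have h : p = Polynomial.C (b₀ ^ 2 - 4 * c₀ * d₀)
      + Polynomial.C (2 * b₀ * b₁ - 4 * (c₀ * d₁ + c₁ * d₀)) * Polynomial.X
      + Polynomial.C (b₁ ^ 2 + 2 * b₀ * b₂ - 4 * (c₀ * d₂ + c₁ * d₁ + c₂ * d₀))
        * Polynomial.X ^ 2
      + Polynomial.C (2 * b₁ * b₂ - 4 * (c₁ * d₂ + c₂ * d₁)) * Polynomial.X ^ 3
      + Polynomial.C (b₂ ^ 2 - 4 * c₂ * d₂) * Polynomial.X ^ 4 := by
    have h4 : (Polynomial.C (4 : ℂ)) = 4 := rfl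
    have h2 : (Polynomial.C (2 : ℂ)) = 2 := rfl
    rw [hp]
    simp only [Polynomial.C_sub, Polynomial.C_add, Polynomial.C_mul, Polynomial.C_pow, h4, h2]
    ring
  have hc : ∀ e₀ e₁ e₂ e₃ e₄ : ℂ, p = Polynomial.C e₀ + Polynomial.C e₁ * Polynomial.X
      + Polynomial.C e₂ * Polynomial.X ^ 2 + Polynomial.C e₃ * Polynomial.X ^ 3
      + Polynomial.C e₄ * Polynomial.X ^ 4 →
      p.coeff 0 = e₀ ∧ p.coeff 1 = e₁ ∧ p.coeff 2 = e₂ ∧ p.coeff 3 = e₃ ∧ p.coeff 4 = e₄ := by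
    rintro e₀ e₁ e₂ e₃ e₄ rfl
    simp [Polynomial.coeff_X, Polynomial.coeff_C, Polynomial.coeff_X_pow]
  exact hc _ _ _ _ _ h

theorem coeff_discrY (a : Matrix (Fin 3) (Fin 3) ℂ) :
    (discrY a).coeff 0 = a 0 1 ^ 2 - 4 * a 0 2 * a 0 0 ∧
    (discrY a).coeff 1 = 2 * a 0 1 * a 1 1 - 4 * (a 0 2 * a 1 0 + a 1 2 * a 0 0) ∧
    (discrY a).coeff 2 = a 1 1 ^ 2 + 2 * a 0 1 * a 2 1
      - 4 * (a 0 2 * a 2 0 + a 1 2 * a 1 0 + a 2 2 * a 0 0) ∧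
    (discrY a).coeff 3 = 2 * a 1 1 * a 2 1 - 4 * (a 1 2 * a 2 0 + a 2 2 * a 1 0) ∧
    (discrY a).coeff 4 = a 2 1 ^ 2 - 4 * a 2 2 * a 2 0 :=
  coeff_quartic _ _ _ _ _ _ _ _ _ _ (by simp [discrY, coeffY, Fin.sum_univ_three])

theorem coeff_discrX (a : Matrix (Fin 3) (Fin 3) ℂ) :
    (discrX a).coeff 0 = a 1 0 ^ 2 - 4 * a 2 0 * a 0 0 ∧
    (discrX a).coeff 1 = 2 * a 1 0 * a 1 1 - 4 * (a 2 0 * a 0 1 + a 2 1 * a 0 0) ∧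
    (discrX a).coeff 2 = a 1 1 ^ 2 + 2 * a 1 0 * a 1 2
      - 4 * (a 2 0 * a 0 2 + a 2 1 * a 0 1 + a 2 2 * a 0 0) ∧
    (discrX a).coeff 3 = 2 * a 1 1 * a 1 2 - 4 * (a 2 1 * a 0 2 + a 2 2 * a 0 1) ∧
    (discrX a).coeff 4 = a 1 2 ^ 2 - 4 * a 2 2 * a 0 2 :=
  coeff_quartic _ _ _ _ _ _ _ _ _ _ (by simp [discrX, coeffX, Fin.sum_univ_three])

/-- Both discriminants have the same invariants, so `invD` and `invE` do not depend on the choice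
of one of them. -/
theorem invariants_discrX (a : Matrix (Fin 3) (Fin 3) ℂ) :
    eisensteinD (discrX a) = invD a ∧ eisensteinE (discrX a) = invE a := by
  obtain ⟨x0, x1, x2, x3, x4⟩ := coeff_discrX a
  obtain ⟨y0, y1, y2, y3, y4⟩ := coeff_discrY a
  simp only [eisensteinD, eisensteinE, invD, invE, x0, x1, x2, x3, x4, y0, y1, y2, y3, y4]
  constructor <;> ring

/-- The right-hand side of the equation `y² = 4 x³ - D x + E` of the cubic. -/
noncomputable def cubic (a : Matrix (Fin 3) (Fin 3) ℂ) (x : ℂ) : ℂ :=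
  4 * x ^ 3 - invD a * x + invE a

/-- The abscissa of the point `[1 : X : Y]` of the cubic. -/
noncomputable def ptX (a : Matrix (Fin 3) (Fin 3) ℂ) : ℂ :=
  (a 1 1 ^ 2 - 4 * a 1 2 * a 1 0 - 4 * a 2 1 * a 0 1 + 8 * a 0 2 * a 2 0 + 8 * a 2 2 * a 0 0) / 12

/-- The ordinate of the point `[1 : X : Y]` of the cubic. -/
noncomputable def ptY (a : Matrix (Fin 3) (Fin 3) ℂ) : ℂ := a.det

theorem pt_on_cubic (a : Matrix (Fin 3) (Fin 3) ℂ) : ptY a ^ 2 = cubic a (ptX a) := by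
  obtain ⟨y0, y1, y2, y3, y4⟩ := coeff_discrY a
  simp only [cubic, ptX, ptY, invD, invE, eisensteinD, eisensteinE, y0, y1, y2, y3, y4,
    Matrix.det_fin_three]
  ring

/-- For `Y ≠ 0`, the analytic branch near `X` of `√(4 x³ - D x + E)` with value `Y` at `X`
(see the facts below). -/
noncomputable def sqrtBranch (a : Matrix (Fin 3) (Fin 3) ℂ) (x : ℂ) : ℂ :=
  ptY a * (cubic a x / ptY a ^ 2) ^ (1 / 2 : ℂ)

theorem sqrtBranch_ptX (a : Matrix (Fin 3) (Fin 3) ℂ) : sqrtBranch a (ptX a) = ptY a := by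
  by_cases h : ptY a = 0
  · simp [sqrtBranch, h]
  · rw [sqrtBranch, ← pt_on_cubic, div_self (pow_ne_zero 2 h), Complex.one_cpow, mul_one]

theorem sqrtBranch_sq (a : Matrix (Fin 3) (Fin 3) ℂ) (h : ptY a ≠ 0) (x : ℂ) :
    sqrtBranch a x ^ 2 = cubic a x := by
  rw [sqrtBranch, mul_pow, ← Complex.cpow_nat_mul]
  have : ((2 : ℕ) : ℂ) * (1 / 2) = 1 := by norm_num
  rw [this, Complex.cpow_one]
  field_simp

theorem sqrtBranch_analyticAt (a : Matrix (Fin 3) (Fin 3) ℂ) (h : ptY a ≠ 0) :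
    AnalyticAt ℂ (sqrtBranch a) (ptX a) := by
  have h1 : AnalyticAt ℂ (fun x => cubic a x / ptY a ^ 2) (ptX a) := by
    unfold cubic
    fun_prop
  refine analyticAt_const.mul (h1.cpow analyticAt_const ?_)
  rw [← pt_on_cubic, div_self (pow_ne_zero 2 h)]
  exact Complex.one_mem_slitPlane

theorem sqrtBranch_unique (a : Matrix (Fin 3) (Fin 3) ℂ) (h : ptY a ≠ 0) (s : ℂ → ℂ)
    (hs : ContinuousAt s (ptX a)) (hX : s (ptX a) = ptY a)
    (hsq : ∀ᶠ x in nhds (ptX a), s x ^ 2 = cubic a x) : s =ᶠ[nhds (ptX a)] sqrtBranch a := by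
  have h1 : ContinuousAt (fun x => s x + sqrtBranch a x) (ptX a) :=
    hs.add (sqrtBranch_analyticAt a h).continuousAt
  have h2 : s (ptX a) + sqrtBranch a (ptX a) ≠ 0 := by
    rw [hX, sqrtBranch_ptX, ← two_mul]
    exact mul_ne_zero two_ne_zero h
  filter_upwards [hsq, h1.eventually_ne h2] with x hx hne
  have h3 := sqrtBranch_sq a h x
  have h4 : (s x - sqrtBranch a x) * (s x + sqrtBranch a x) = 0 := by
    linear_combination hx - h3
  exact sub_eq_zero.mp ((mul_eq_zero.mp h4).resolve_right hne)

/-- The coefficient `C_k` of the Taylor expansion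
`√(4 x³ - D x + E) = C_0 + C_1 (x - X) + C_2 (x - X)² + ⋯`
about the point `[1 : X : Y]` of the cubic. -/
noncomputable def taylorCoeff (a : Matrix (Fin 3) (Fin 3) ℂ) (k : ℕ) : ℂ :=
  iteratedDeriv k (sqrtBranch a) (ptX a) / (Nat.factorial k : ℂ)

end Biquadratic

/-!
The composite of the two switches is a translation of an elliptic curve by a point that the
determinant and the Taylor coefficients describe.

The walk group is generated by two involutions. Neither is trivial, since a trivial switch would
make a discriminant of the biquadratic polynomial vanish identically and `F` with it, so the
group is dihedral and its order is twice the order of the composite `T` of the switches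
(`card_closure_pair`, `card_walkGroup`).

Coordinate changes in the two factors of `P1 × P1` conjugate the switches and multiply `D`, `X`,
`Y` by the fourth, second and third powers of one nonzero number (`Similar`). Move a branch
point of the first projection, and then the point of the curve above it, to infinity. The
equation becomes `x y² + a₁ x y + e y = x² + b x + c` (`exists_similar_tateForm`). Multiplied by
`x`, in the variables `x` and `η = x y`, it is the Weierstrass cubic
`η² + a₁ x η + e η = x³ + b x² + c x`, which passes through the origin `Q`; here `x` is the abscissa of a point and `y` the
slope of its line to `Q`. The vertical switch preserves the abscissa, so it is `P ↦ -P`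
(`verticalSwitch_toCurve`). The horizontal switch exchanges the two further points of a line
through `Q`, so it is `P ↦ -(Q + P)` (`horizontalSwitch_toCurve`). Hence `T` is the translation
by `-Q`, and its order is the order of `Q` in the group of points of the cubic
(`orderOf_tateForm`).

The determinant of the normal form is `-e`, which vanishes exactly when `2 Q = 0`. If `e ≠ 0`, a
shift of `y` achieves `c = 0`, and the first multiples of `Q` are short expressions in `a₁`,
`b`, `e`. The conditions `n Q = 0`, for `n = 3, 4, 5, 6`, say that `2 Q = -Q`, `2 Q = -2 Q`,
`3 Q = -2 Q`, `3 Q = -3 Q`. On the other side, squaring the Taylor series gives a recursion for its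
coefficients (`taylorCoeff_relations`). It yields the closed formulas, and in terms of the
normal form it turns the conditions on the coefficients into those on the multiples of `Q`
(`orderOf_iff_taylorCoeff`).
-/

namespace Biquadratic

/-! ### Pairs of roots in arbitrary homogeneous coordinates -/

theorem bracket_smul_smul (r s : ℂ) (u v : Fin 2 → ℂ) :
    bracket (r • u) (s • v) = r * s * bracket u v := by
  simp only [bracket, Pi.smul_apply, smul_eq_mul]
  ring

/-- Root pairs can be tested on any homogeneous coordinates. -/
theorem isRootPair_mk {q : (Fin 2 → ℂ) → ℂ} {u w : Fin 2 → ℂ} (hu : u ≠ 0) (hw : w ≠ 0) :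
    IsRootPair q (Projectivization.mk ℂ u hu) (Projectivization.mk ℂ w hw) ↔
      ∃ c : ℂ, c ≠ 0 ∧ ∀ z, q z = c * bracket z u * bracket z w := by
  obtain ⟨r, hr⟩ := Projectivization.exists_smul_eq_mk_rep ℂ u hu
  obtain ⟨s, hs⟩ := Projectivization.exists_smul_eq_mk_rep ℂ w hw
  have hr0 := r.ne_zero
  have hs0 := s.ne_zero
  have hb : ∀ (t : ℂ) (z v : Fin 2 → ℂ), bracket z (t • v) = t * bracket z v := fun t z v => by
    simpa using bracket_smul_smul 1 t z v
  simp only [IsRootPair, ← hr, ← hs, Units.smul_def, hb]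
  constructor
  · rintro ⟨c, hc, h⟩
    exact ⟨c * r * s, by simp [hc], fun z => by rw [h]; ring⟩
  · rintro ⟨c, hc, h⟩
    refine ⟨c / (r * s), by simp [hc], fun z => ?_⟩
    rw [h]
    field_simp

theorem isRootPair_const_mul {q : (Fin 2 → ℂ) → ℂ} {k : ℂ} (hk : k ≠ 0) {P P' : P1} :
    IsRootPair (fun u => k * q u) P P' ↔ IsRootPair q P P' := by
  constructor
  · rintro ⟨c, hc, h⟩
    refine ⟨c / k, div_ne_zero hc hk, fun u => ?_⟩
    have := h u
    field_simp
    linear_combination this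
  · rintro ⟨c, hc, h⟩
    exact ⟨k * c, mul_ne_zero hk hc, fun u => by simp only [h]; ring⟩

theorem otherRoot_congr {q q' : (Fin 2 → ℂ) → ℂ} {P : P1}
    (h : ∀ P', IsRootPair q P P' ↔ IsRootPair q' P P') : otherRoot q P = otherRoot q' P := by
  by_cases hq : ∃ P', IsRootPair q P P'
  · obtain ⟨P', hP⟩ := hq
    rw [otherRoot_eq hP, otherRoot_eq ((h P').1 hP)]
  · have hq' : ¬ ∃ P', IsRootPair q' P P' := by simpa only [h] using hq
    rw [otherRoot, otherRoot, dif_neg hq, dif_neg hq']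

/-- The linear action of `GL₂` on binary forms moves root pairs along. -/
theorem isRootPair_smul {q : (Fin 2 → ℂ) → ℂ} (g : GL (Fin 2) ℂ) {P P' : P1} :
    IsRootPair q (g • P) (g • P') ↔ IsRootPair (fun u => q (g • u)) P P' := by
  induction P using Projectivization.ind with | h u hu => ?_
  induction P' using Projectivization.ind with | h w hw => ?_
  have hd : g.det.val ≠ 0 := g.det.ne_zero
  have hb : ∀ z v : Fin 2 → ℂ, bracket (g • z) (g • v) = g.det.val * bracket z v := fun z v => by
    change bracket (g.val.mulVec z) (g.val.mulVec v) = g.val.det * _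
    simp only [bracket, Matrix.mulVec, dotProduct, Fin.sum_univ_two, Matrix.det_fin_two]
    ring
  rw [Projectivization.smul_mk, Projectivization.smul_mk, isRootPair_mk, isRootPair_mk]
  constructor
  · rintro ⟨c, hc, h⟩
    refine ⟨c * g.det.val ^ 2, mul_ne_zero hc (pow_ne_zero 2 hd), fun z => ?_⟩
    rw [h, hb, hb]
    ring
  · rintro ⟨c, hc, h⟩
    refine ⟨c / g.det.val ^ 2, div_ne_zero hc (pow_ne_zero 2 hd), fun z => ?_⟩
    have h1 := h (g⁻¹ • z)
    have h2 := hb (g⁻¹ • z)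
    simp only [smul_inv_smul] at h1 h2
    rw [h1, h2, h2]
    field_simp

theorem otherRoot_smul (q : (Fin 2 → ℂ) → ℂ) (g : GL (Fin 2) ℂ) (P : P1) :
    otherRoot q (g • P) = g • otherRoot (fun u => q (g • u)) P := by
  by_cases h : ∃ P', IsRootPair (fun u => q (g • u)) P P'
  · obtain ⟨P', h⟩ := h
    rw [otherRoot_eq h, otherRoot_eq ((isRootPair_smul g).2 h)]
  · have h' : ¬ ∃ P', IsRootPair q (g • P) P' := by
      rintro ⟨P', h'⟩
      refine h ⟨g⁻¹ • P', (isRootPair_smul g).1 ?_⟩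
      rwa [smul_inv_smul]
    rw [otherRoot, otherRoot, dif_neg h, dif_neg h']

theorem horizontalSwitch_eq {a : Matrix (Fin 3) (Fin 3) ℂ} {p p' : curve a} {u u' w : Fin 2 → ℂ}
    (hu : u ≠ 0) (hu' : u' ≠ 0) (hw : w ≠ 0)
    (hp : p.1 = (Projectivization.mk ℂ u hu, Projectivization.mk ℂ w hw))
    (hp' : p'.1 = (Projectivization.mk ℂ u' hu', Projectivization.mk ℂ w hw)) {c : ℂ} (hc : c ≠ 0)
    (h : ∀ z, form a z w = c * bracket z u * bracket z u') : horizontalSwitch a p = p' := by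
  obtain ⟨r, hr⟩ := Projectivization.exists_smul_eq_mk_rep ℂ w hw
  have hq : ∀ z, form a z (Projectivization.mk ℂ w hw).rep = (r : ℂ) ^ 2 * form a z w := fun z => by
    simpa [← hr, Units.smul_def] using form_smul a 1 r z w
  refine Subtype.ext ?_
  change (otherRoot (fun u => form a u p.1.2.rep) p.1.1, p.1.2) = p'.1
  rw [hp', hp]
  simp only [hq]
  rw [otherRoot_eq ((isRootPair_const_mul (pow_ne_zero 2 r.ne_zero)).2
    ((isRootPair_mk hu hu').2 ⟨c, hc, h⟩))]

theorem verticalSwitch_eq {a : Matrix (Fin 3) (Fin 3) ℂ} {p p' : curve a} {u w w' : Fin 2 → ℂ}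
    (hu : u ≠ 0) (hw : w ≠ 0) (hw' : w' ≠ 0)
    (hp : p.1 = (Projectivization.mk ℂ u hu, Projectivization.mk ℂ w hw))
    (hp' : p'.1 = (Projectivization.mk ℂ u hu, Projectivization.mk ℂ w' hw')) {c : ℂ} (hc : c ≠ 0)
    (h : ∀ z, form a u z = c * bracket z w * bracket z w') : verticalSwitch a p = p' := by
  obtain ⟨r, hr⟩ := Projectivization.exists_smul_eq_mk_rep ℂ u hu
  have hq : ∀ z, form a (Projectivization.mk ℂ u hu).rep z = (r : ℂ) ^ 2 * form a u z := fun z => by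
    simpa [← hr, Units.smul_def] using form_smul a r 1 u z
  refine Subtype.ext ?_
  change (p.1.1, otherRoot (fun u => form a p.1.1.rep u) p.1.2) = p'.1
  rw [hp', hp]
  simp only [hq]
  rw [otherRoot_eq ((isRootPair_const_mul (pow_ne_zero 2 r.ne_zero)).2
    ((isRootPair_mk hw hw').2 ⟨c, hc, h⟩))]

theorem horizontalSwitch_mul_self (a : Matrix (Fin 3) (Fin 3) ℂ) :
    horizontalSwitch a * horizontalSwitch a = 1 :=
  Equiv.ext fun p => Function.Involutive.toPerm_involutive _ p

theorem verticalSwitch_mul_self (a : Matrix (Fin 3) (Fin 3) ℂ) :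
    verticalSwitch a * verticalSwitch a = 1 :=
  Equiv.ext fun p => Function.Involutive.toPerm_involutive _ p

/-! ### Coordinate changes -/

/-- The curve of `aᵀ` is the curve of `a` with the two factors exchanged. -/
theorem form_transpose (a : Matrix (Fin 3) (Fin 3) ℂ) (x y : Fin 2 → ℂ) :
    form a.transpose x y = form a y x := by
  simp only [form, Matrix.transpose_apply]
  rw [Finset.sum_comm]
  exact Finset.sum_congr rfl fun i _ => Finset.sum_congr rfl fun j _ => by ring

/-- Exchanging the factors, as a bijection between the curves of `aᵀ` and `a`. -/
noncomputable def transposeEquiv (a : Matrix (Fin 3) (Fin 3) ℂ) : curve a.transpose ≃ curve a :=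
  (Equiv.prodComm P1 P1).subtypeEquiv fun p => by
    simp [curve, form_transpose]

theorem orderOf_transpose (a : Matrix (Fin 3) (Fin 3) ℂ) :
    orderOf (horizontalSwitch a.transpose * verticalSwitch a.transpose) =
      orderOf (horizontalSwitch a * verticalSwitch a) := by
  have hh : (transposeEquiv a).permCongrHom (horizontalSwitch a.transpose) = verticalSwitch a := by
    ext1 p
    refine Subtype.ext (Prod.ext rfl ?_)
    change otherRoot (fun u => form a.transpose u p.1.1.rep) p.1.2 = _
    simp only [form_transpose]
    rfl
  have hv : (transposeEquiv a).permCongrHom (verticalSwitch a.transpose) = horizontalSwitch a := by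
    ext1 p
    refine Subtype.ext (Prod.ext ?_ rfl)
    change otherRoot (fun u => form a.transpose p.1.2.rep u) p.1.1 = _
    simp only [form_transpose]
    rfl
  rw [← (transposeEquiv a).permCongrHom.orderOf_eq, map_mul, hh, hv, ← orderOf_inv, mul_inv_rev,
    inv_eq_of_mul_eq_one_right (horizontalSwitch_mul_self a),
    inv_eq_of_mul_eq_one_right (verticalSwitch_mul_self a)]

/-- The matrix of the substitution of `g • x` for `x` in binary quadratic forms, in the monomials
`x₀²`, `x₁ x₀`, `x₁²`. -/
def symSq (g : Matrix (Fin 2) (Fin 2) ℂ) : Matrix (Fin 3) (Fin 3) ℂ :=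
  !![g 0 0 ^ 2, g 0 0 * g 1 0, g 1 0 ^ 2;
    2 * g 0 0 * g 0 1, g 0 0 * g 1 1 + g 0 1 * g 1 0, 2 * g 1 0 * g 1 1;
    g 0 1 ^ 2, g 0 1 * g 1 1, g 1 1 ^ 2]

theorem form_symSq_mul (a : Matrix (Fin 3) (Fin 3) ℂ) (g : GL (Fin 2) ℂ) (x y : Fin 2 → ℂ) :
    form (symSq g.val * a) x y = form a (g • x) y := by
  change _ = form a (g.val.mulVec x) y
  simp only [form, symSq, Fin.sum_univ_three, Matrix.mul_apply, Matrix.mulVec, dotProduct,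
    Fin.sum_univ_two]
  simp
  ring

/-- The chosen representative of `g • P` and the image of that of `P` are proportional, so they give
proportional forms in `y`. -/
theorem form_smul_rep (a : Matrix (Fin 3) (Fin 3) ℂ) (g : GL (Fin 2) ℂ) (P : P1) :
    ∃ k : ℂ, k ≠ 0 ∧ ∀ y, form a (g • P).rep y = k * form a (g • P.rep) y := by
  have h0 : g • P.rep ≠ 0 := (smul_ne_zero_iff_ne g).2 P.rep_nonzero
  have hP : g • P = Projectivization.mk ℂ (g • P.rep) h0 := by
    conv_lhs => rw [← P.mk_rep]
    exact Projectivization.smul_mk g P.rep_nonzero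
  obtain ⟨r, hr⟩ := Projectivization.exists_smul_eq_mk_rep ℂ _ h0
  refine ⟨(r : ℂ) ^ 2, pow_ne_zero 2 r.ne_zero, fun y => ?_⟩
  rw [hP, ← hr, Units.smul_def]
  simpa using form_smul a r 1 (g • P.rep) y

/-- The coordinate change `g` of the first factor, as a bijection between curves. -/
noncomputable def symSqEquiv (a : Matrix (Fin 3) (Fin 3) ℂ) (g : GL (Fin 2) ℂ) :
    curve (symSq g.val * a) ≃ curve a :=
  ((MulAction.toPerm g).prodCongr (Equiv.refl P1)).subtypeEquiv fun p => by
    obtain ⟨k, hk, h⟩ := form_smul_rep a g p.1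
    simp [curve, h, hk, form_symSq_mul]

theorem orderOf_symSq_mul (a : Matrix (Fin 3) (Fin 3) ℂ) (g : GL (Fin 2) ℂ) :
    orderOf (horizontalSwitch (symSq g.val * a) * verticalSwitch (symSq g.val * a)) =
      orderOf (horizontalSwitch a * verticalSwitch a) := by
  have hh : (symSqEquiv a g).permCongrHom (horizontalSwitch (symSq g.val * a)) =
      horizontalSwitch a := by
    ext1 p
    obtain ⟨p, rfl⟩ := (symSqEquiv a g).surjective p
    refine Subtype.ext (Prod.ext ?_ ?_)
    · simp only [Equiv.permCongrHom_coe, Equiv.permCongr_apply, Equiv.symm_apply_apply]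
      change g • otherRoot (fun u => form (symSq g.val * a) u p.1.2.rep) p.1.1 =
        otherRoot (fun u => form a u p.1.2.rep) (g • p.1.1)
      simp only [form_symSq_mul, otherRoot_smul]
    · simp only [Equiv.permCongrHom_coe, Equiv.permCongr_apply, Equiv.symm_apply_apply]
      rfl
  have hv : (symSqEquiv a g).permCongrHom (verticalSwitch (symSq g.val * a)) =
      verticalSwitch a := by
    ext1 p
    obtain ⟨p, rfl⟩ := (symSqEquiv a g).surjective p
    refine Subtype.ext (Prod.ext ?_ ?_)
    · simp only [Equiv.permCongrHom_coe, Equiv.permCongr_apply, Equiv.symm_apply_apply]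
      rfl
    · simp only [Equiv.permCongrHom_coe, Equiv.permCongr_apply, Equiv.symm_apply_apply]
      change otherRoot (fun u => form (symSq g.val * a) p.1.1.rep u) p.1.2 =
        otherRoot (fun u => form a (g • p.1.1).rep u) p.1.2
      obtain ⟨k, hk, h⟩ := form_smul_rep a g p.1.1
      simp only [form_symSq_mul, h]
      exact otherRoot_congr fun P' => (isRootPair_const_mul hk).symm
  rw [← (symSqEquiv a g).permCongrHom.orderOf_eq, map_mul, hh, hv]

/-! ### The order of a group generated by two involutions -/

/-- Two nontrivial involutions generate a dihedral group; infinite groups are covered by the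
convention that both `orderOf` and `Nat.card` are then `0`. -/
theorem card_closure_pair {G : Type*} [Group G] {s t : G} (hs : s * s = 1) (ht : t * t = 1)
    (hs1 : s ≠ 1) (ht1 : t ≠ 1) :
    Nat.card (Subgroup.closure {s, t}) = 2 * orderOf (s * t) := by
  have hsi : s⁻¹ = s := inv_eq_of_mul_eq_one_right hs
  have hti : t⁻¹ = t := inv_eq_of_mul_eq_one_right ht
  have hconj : ∀ k : ℤ, s * (s * t) ^ k = (s * t) ^ (-k) * s := fun k => by
    have h1 : s * (s * t) * s⁻¹ = (s * t)⁻¹ := by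
      rw [mul_inv_rev, hsi, hti, ← mul_assoc, hs, one_mul]
    rw [zpow_neg, ← inv_zpow, ← h1, conj_zpow]
    group
  -- A reflection that is a power of the rotation commutes with it, so the rotation has order
  -- at most two, and then one of the involutions is trivial.
  have hsz : s ∉ Subgroup.zpowers (s * t) := by
    rintro ⟨k, hk⟩
    simp only at hk
    have hc : Commute s (s * t) := by
      have := (Commute.refl (s * t)).zpow_left k
      rwa [hk] at this
    have hst : Commute s t := by
      have := hc.eq
      rw [mul_assoc] at this
      exact mul_left_cancel this
    have h2 : (s * t) ^ (2 : ℤ) = 1 := by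
      rw [hst.mul_zpow, zpow_two, zpow_two, hs, ht, one_mul]
    obtain ⟨m, rfl | rfl⟩ := k.even_or_odd'
    · rw [zpow_mul, h2, one_zpow] at hk
      exact hs1 hk.symm
    · rw [zpow_add, zpow_mul, h2, one_zpow, one_mul, zpow_one] at hk
      exact ht1 (by simpa using hk)
  let H := Subgroup.zpowers (s * t)
  have hmem : ∀ x, x ∈ Subgroup.closure {s, t} ↔ x ∈ H ∨ s * x ∈ H := by
    intro x
    constructor
    · intro hx
      induction hx using Subgroup.closure_induction with
      | mem x hx =>
        rcases hx with rfl | rfl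
        · exact Or.inr (hs ▸ H.one_mem)
        · exact Or.inr (Subgroup.mem_zpowers _)
      | one => exact Or.inl H.one_mem
      | mul x y _ _ hx hy =>
        have hcc : ∀ z ∈ H, s * z * s ∈ H := by
          rintro _ ⟨k, rfl⟩
          refine ⟨-k, ?_⟩
          simp only
          rw [hconj, mul_assoc, hs, mul_one]
        rcases hx with hx | hx <;> rcases hy with hy | hy
        · exact Or.inl (H.mul_mem hx hy)
        · refine Or.inr ?_
          have := H.mul_mem (hcc x hx) hy
          rwa [mul_assoc, ← mul_assoc s s, hs, one_mul, mul_assoc] at this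
        · exact Or.inr (by simpa [mul_assoc] using H.mul_mem hx hy)
        · refine Or.inl ?_
          have := H.mul_mem (hcc _ hx) hy
          rwa [← mul_assoc s s, hs, one_mul, mul_assoc, ← mul_assoc s s, hs, one_mul] at this
      | inv x _ hx =>
        rcases hx with hx | hx
        · exact Or.inl (H.inv_mem hx)
        · refine Or.inr ?_
          obtain ⟨k, hk⟩ := hx
          simp only at hk
          refine ⟨k, ?_⟩
          have hx' : x = s * (s * t) ^ k := by rw [hk, ← mul_assoc, hs, one_mul]
          simp only
          rw [hx', mul_inv_rev, hsi, ← zpow_neg, ← hconj, ← mul_assoc, hs, one_mul]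
    · have hsc : s ∈ Subgroup.closure {s, t} := Subgroup.subset_closure (by simp)
      have htc : t ∈ Subgroup.closure {s, t} := Subgroup.subset_closure (by simp)
      have hH : H ≤ Subgroup.closure {s, t} :=
        (Subgroup.zpowers_le).2 (Subgroup.mul_mem _ hsc htc)
      rintro (hx | hx)
      · exact hH hx
      · exact (Subgroup.mul_mem_cancel_left _ hsc).1 (hH hx)
  let f : H ⊕ H → Subgroup.closure {s, t} := Sum.elim
    (fun x => ⟨x, (hmem x).2 (Or.inl x.2)⟩)
    (fun x => ⟨s * x, (hmem _).2 (Or.inr (by rw [← mul_assoc, hs, one_mul]; exact x.2))⟩)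
  have hf : Function.Bijective f := by
    constructor
    · have key : ∀ x y : H, (x : G) ≠ s * y := fun x y hxy => hsz <| by
        have : s = x * (y : G)⁻¹ := by rw [hxy]; group
        have hxy' := H.mul_mem x.2 (H.inv_mem y.2)
        rwa [← this] at hxy'
      have hval : ∀ {p q : H ⊕ H}, f p = f q → (f p : G) = f q := fun h => congrArg _ h
      rintro (x | x) (y | y) hxy
      · exact congrArg Sum.inl (Subtype.ext (hval hxy))
      · exact (key x y (hval hxy)).elim
      · exact (key y x (hval hxy).symm).elim
      · exact congrArg Sum.inr (Subtype.ext (mul_left_cancel (hval hxy)))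
    · rintro ⟨x, hx⟩
      rcases (hmem x).1 hx with hx | hx
      · exact ⟨Sum.inl ⟨x, hx⟩, rfl⟩
      · exact ⟨Sum.inr ⟨s * x, hx⟩, Subtype.ext (by
          change s * (s * x) = x
          rw [← mul_assoc, hs, one_mul])⟩
  rw [← Nat.card_congr (Equiv.ofBijective f hf)]
  rcases finite_or_infinite H with hfin | hinf
  · rw [Nat.card_sum, Nat.card_zpowers, two_mul]
  · have h0 : orderOf (s * t) = 0 := by
      rw [← Nat.card_zpowers]
      exact Nat.card_eq_zero_of_infinite
    rw [h0, Nat.card_eq_zero_of_infinite]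

/-! ### The walk group is dihedral -/

/-- If the vertical switch is the identity, the discriminant vanishes on the whole line. -/
theorem verticalSwitch_ne_one {a : Matrix (Fin 3) (Fin 3) ℂ} (hF : invF a ≠ 0) :
    verticalSwitch a ≠ 1 := by
  intro hv
  have hd : discrY a = 0 := by
    refine Polynomial.funext fun x => ?_
    have he : ∀ j, (coeffY a j).eval x = a 0 j + a 1 j * x + a 2 j * x ^ 2 := fun j => by
      simp [coeffY, Fin.sum_univ_three]
    simp only [discrY, Polynomial.eval_sub, Polynomial.eval_mul, Polynomial.eval_pow, he,
      Polynomial.eval_zero, Polynomial.eval_ofNat]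
    set A := a 0 2 + a 1 2 * x + a 2 2 * x ^ 2
    set B := a 0 1 + a 1 1 * x + a 2 1 * x ^ 2
    set C := a 0 0 + a 1 0 * x + a 2 0 * x ^ 2
    by_contra hne
    obtain ⟨r, hr⟩ := IsAlgClosed.exists_pow_nat_eq (B ^ 2 - 4 * A * C) (n := 2) two_pos
    have hr0 : r ≠ 0 := by
      rintro rfl
      exact hne (by rw [← hr]; ring)
    have hq : ∀ z, form a ![1, x] z = A * z 1 ^ 2 + B * z 1 * z 0 + C * z 0 ^ 2 := fun z => by
      simp only [form, Fin.sum_univ_three, A, B, C]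
      simp
      ring
    have hx0 : (![1, x] : Fin 2 → ℂ) ≠ 0 := fun h => by simpa using congrFun h 0
    -- The two roots of the fibre over `x`, with nonzero bracket.
    have key : ∃ w w' : Fin 2 → ℂ, ∃ c : ℂ, c ≠ 0 ∧ bracket w w' ≠ 0 ∧
        ∀ z, form a ![1, x] z = c * bracket z w * bracket z w' := by
      by_cases hA : A = 0
      · have hB : B ≠ 0 := by
          rintro hB
          exact hne (by rw [hA, hB]; ring)
        refine ⟨![0, 1], ![B, -C], -1, by simp, by simpa [bracket] using hB, fun z => ?_⟩
        rw [hq, hA]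
        simp [bracket]
        ring
      · refine ⟨![2 * A, -B + r], ![2 * A, -B - r], (4 * A)⁻¹, by simpa using hA, ?_, fun z => ?_⟩
        · have : bracket ![2 * A, -B + r] ![2 * A, -B - r] = -4 * A * r := by
            simp [bracket]
            ring
          rw [this]
          simp [hA, hr0]
        · rw [hq]
          simp [bracket]
          field_simp
          linear_combination z 0 ^ 2 * hr
    obtain ⟨w, w', c, hc, hb, h⟩ := key
    have hw : w ≠ 0 := by
      rintro rfl
      exact hb (by simp [bracket])
    have hw' : w' ≠ 0 := by
      rintro rfl
      exact hb (by simp [bracket])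
    let p : curve a := ⟨_, (mk_mem_curve a _ w hx0 hw).2 (by rw [h, bracket_self]; ring)⟩
    let p' : curve a := ⟨_, (mk_mem_curve a _ w' hx0 hw').2 (by rw [h, bracket_self]; ring)⟩
    have hpp : verticalSwitch a p = p' := verticalSwitch_eq hx0 hw hw' rfl rfl hc h
    rw [hv] at hpp
    have := congrArg (fun p => p.1.2) hpp
    obtain ⟨k, rfl⟩ := (Projectivization.mk_eq_mk_iff' ℂ _ _ hw hw').1 this
    exact hb (by simp [bracket]; ring)
  exact hF (by simp [invF, invD, invE, eisensteinD, eisensteinE, hd])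

theorem discrY_transpose (a : Matrix (Fin 3) (Fin 3) ℂ) : discrY a.transpose = discrX a := by
  simp [discrY, discrX, coeffY, coeffX]

theorem invF_transpose (a : Matrix (Fin 3) (Fin 3) ℂ) : invF a.transpose = invF a := by
  obtain ⟨h1, h2⟩ := invariants_discrX a
  simp only [invF, ← h1, ← h2]
  simp only [invD, invE, discrY_transpose]

theorem horizontalSwitch_ne_one {a : Matrix (Fin 3) (Fin 3) ℂ} (hF : invF a ≠ 0) :
    horizontalSwitch a ≠ 1 := by
  intro h
  rw [← invF_transpose] at hF
  refine verticalSwitch_ne_one hF (Equiv.ext fun p => Subtype.ext (Prod.ext rfl ?_))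
  have := congrArg (fun p => p.1.1) (Equiv.congr_fun h (transposeEquiv a p))
  change otherRoot (fun u => form a u p.1.1.rep) p.1.2 = p.1.2 at this
  change otherRoot (fun u => form a.transpose p.1.1.rep u) p.1.2 = p.1.2
  simpa only [form_transpose] using this

/-- The switches of a smooth curve are nontrivial involutions, so its walk group is dihedral. -/
theorem card_walkGroup {a : Matrix (Fin 3) (Fin 3) ℂ} (hF : invF a ≠ 0) :
    Nat.card (walkGroup a) = 2 * orderOf (horizontalSwitch a * verticalSwitch a) :=
  card_closure_pair (horizontalSwitch_mul_self a) (verticalSwitch_mul_self a)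
    (horizontalSwitch_ne_one hF) (verticalSwitch_ne_one hF)

/-! ### Transformation of the invariants -/

theorem det_symSq (g : Matrix (Fin 2) (Fin 2) ℂ) : (symSq g).det = g.det ^ 3 := by
  simp [symSq, Matrix.det_fin_three, Matrix.det_fin_two]
  ring

theorem invD_symSq_mul (a : Matrix (Fin 3) (Fin 3) ℂ) (g : Matrix (Fin 2) (Fin 2) ℂ) :
    invD (symSq g * a) = g.det ^ 4 * invD a := by
  -- The discriminant with respect to `x`, a quartic in the untouched variable `y`, is multiplied
  -- by `g.det ^ 2`.
  rw [← (invariants_discrX (symSq g * a)).1, ← (invariants_discrX a).1]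
  obtain ⟨x0, x1, x2, x3, x4⟩ := coeff_discrX a
  obtain ⟨y0, y1, y2, y3, y4⟩ := coeff_discrX (symSq g * a)
  have h : ∀ n ∈ Finset.range 5,
      (discrX (symSq g * a)).coeff n = g.det ^ 2 * (discrX a).coeff n := by
    intro n hn
    have : n = 0 ∨ n = 1 ∨ n = 2 ∨ n = 3 ∨ n = 4 := by
      rw [Finset.mem_range] at hn
      omega
    rcases this with rfl | rfl | rfl | rfl | rfl
    · rw [x0, y0]
      simp [symSq, Matrix.mul_apply, Fin.sum_univ_three, Matrix.det_fin_two]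
      ring
    · rw [x1, y1]
      simp [symSq, Matrix.mul_apply, Fin.sum_univ_three, Matrix.det_fin_two]
      ring
    · rw [x2, y2]
      simp [symSq, Matrix.mul_apply, Fin.sum_univ_three, Matrix.det_fin_two]
      ring
    · rw [x3, y3]
      simp [symSq, Matrix.mul_apply, Fin.sum_univ_three, Matrix.det_fin_two]
      ring
    · rw [x4, y4]
      simp [symSq, Matrix.mul_apply, Fin.sum_univ_three, Matrix.det_fin_two]
      ring
  simp only [eisensteinD, h 0 (by simp), h 1 (by simp), h 2 (by simp), h 3 (by simp),
    h 4 (by simp)]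
  ring

theorem ptX_symSq_mul (a : Matrix (Fin 3) (Fin 3) ℂ) (g : Matrix (Fin 2) (Fin 2) ℂ) :
    ptX (symSq g * a) = g.det ^ 2 * ptX a := by
  simp [ptX, symSq, Matrix.mul_apply, Fin.sum_univ_three, Matrix.det_fin_two]
  ring

/-- `E` is determined by `D`, `X`, `Y`, as the point `(X, Y)` lies on the cubic. -/
theorem invE_eq (a : Matrix (Fin 3) (Fin 3) ℂ) :
    invE a = ptY a ^ 2 - 4 * ptX a ^ 3 + invD a * ptX a := by
  rw [pt_on_cubic, cubic]
  ring

/-- The biquadratic `a'` has the same walk order as `a`, and proportional invariants, as is the case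
after a change of coordinates of `P1 × P1`. Only `D`, `X`, `Y` are recorded, since
they determine `E`. -/
def Similar (a a' : Matrix (Fin 3) (Fin 3) ℂ) : Prop :=
  ∃ δ : ℂ, δ ≠ 0 ∧ invD a' = δ ^ 4 * invD a ∧ ptX a' = δ ^ 2 * ptX a ∧ ptY a' = δ ^ 3 * ptY a ∧
    orderOf (horizontalSwitch a' * verticalSwitch a') =
      orderOf (horizontalSwitch a * verticalSwitch a)

theorem Similar.refl (a : Matrix (Fin 3) (Fin 3) ℂ) : Similar a a :=
  ⟨1, one_ne_zero, by ring, by ring, by ring, rfl⟩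

theorem Similar.trans {a b c : Matrix (Fin 3) (Fin 3) ℂ} (h : Similar a b) (h' : Similar b c) :
    Similar a c := by
  obtain ⟨δ, h0, h1, h2, h3, h4⟩ := h
  obtain ⟨δ', h0', h1', h2', h3', h4'⟩ := h'
  exact ⟨δ * δ', mul_ne_zero h0 h0', by rw [h1', h1]; ring, by rw [h2', h2]; ring,
    by rw [h3', h3]; ring, h4'.trans h4⟩

theorem Similar.invF_ne_zero {a b : Matrix (Fin 3) (Fin 3) ℂ} (h : Similar a b)
    (hF : invF a ≠ 0) : invF b ≠ 0 := by
  obtain ⟨δ, h0, h1, h2, h3, -⟩ := h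
  have : invF b = δ ^ 12 * invF a := by
    simp only [invF, invE_eq, h1, h2, h3]
    ring
  rw [this]
  exact mul_ne_zero (pow_ne_zero _ h0) hF

theorem similar_transpose (a : Matrix (Fin 3) (Fin 3) ℂ) : Similar a a.transpose := by
  refine ⟨1, one_ne_zero, ?_, ?_, ?_, orderOf_transpose a⟩
  · rw [invD, discrY_transpose, (invariants_discrX a).1]
    ring
  · simp only [ptX, Matrix.transpose_apply]
    ring
  · simp only [ptY, Matrix.det_transpose]
    ring

theorem similar_symSq_mul (a : Matrix (Fin 3) (Fin 3) ℂ) {g : Matrix (Fin 2) (Fin 2) ℂ}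
    (hg : g.det ≠ 0) : Similar a (symSq g * a) :=
  ⟨g.det, hg, invD_symSq_mul a g, ptX_symSq_mul a g, by rw [ptY, Matrix.det_mul, det_symSq, ptY],
    orderOf_symSq_mul a (Matrix.GeneralLinearGroup.mkOfDetNeZero g hg)⟩

theorem similar_mul_symSq (a : Matrix (Fin 3) (Fin 3) ℂ) {g : Matrix (Fin 2) (Fin 2) ℂ}
    (hg : g.det ≠ 0) : Similar a (a * (symSq g).transpose) := by
  have h := ((similar_transpose a).trans (similar_symSq_mul a.transpose hg)).trans
    (similar_transpose _)
  rwa [Matrix.transpose_mul, Matrix.transpose_transpose] at h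

/-! ### The normal form -/

/-- The biquadratic `x y² + a₁ x y + e y - (x² + b x + c)`. -/
def tateForm (a₁ b e c : ℂ) : Matrix (Fin 3) (Fin 3) ℂ :=
  !![-c, e, 0; -b, a₁, 1; -1, 0, 0]

/-- Smoothness excludes a multiple root of the discriminant at infinity. -/
theorem invF_eq_zero_of_coeff {a : Matrix (Fin 3) (Fin 3) ℂ} (h3 : (discrY a).coeff 3 = 0)
    (h4 : (discrY a).coeff 4 = 0) : invF a = 0 := by
  simp only [invF, invD, invE, eisensteinD, eisensteinE, h3, h4]
  ring

/-- A branch point of the projection to the first factor can be moved to infinity. -/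
theorem exists_similar_coeff_four (a : Matrix (Fin 3) (Fin 3) ℂ) :
    ∃ a', Similar a a' ∧ a' 2 1 ^ 2 = 4 * a' 2 2 * a' 2 0 := by
  have h4 := (coeff_discrY a).2.2.2.2
  by_cases h : (discrY a).coeff 4 = 0
  · refine ⟨a, Similar.refl a, ?_⟩
    linear_combination h - h4
  · have hdeg : (discrY a).degree ≠ 0 := by
      have := Polynomial.le_degree_of_ne_zero h
      intro h0
      rw [h0] at this
      norm_cast at this
    obtain ⟨ξ, hξ⟩ := IsAlgClosed.exists_root _ hdeg
    -- This substitution sends infinity to the root `ξ`.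
    refine ⟨_, similar_symSq_mul a (g := !![0, 1; -1, ξ]) (by simp [Matrix.det_fin_two]), ?_⟩
    simp only [Polynomial.IsRoot, discrY, coeffY, Fin.sum_univ_three, Polynomial.eval_sub,
      Polynomial.eval_mul, Polynomial.eval_pow, Polynomial.eval_ofNat, Polynomial.eval_add,
      Polynomial.eval_C, Polynomial.eval_X] at hξ
    simp [symSq, Matrix.mul_apply, Fin.sum_univ_three]
    simp at hξ
    linear_combination hξ

/-- The point of the fibre over infinity, which is then a double root, can also be moved to
infinity. -/
theorem exists_similar_corner (a : Matrix (Fin 3) (Fin 3) ℂ) :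
    ∃ a', Similar a a' ∧ a' 2 1 = 0 ∧ a' 2 2 = 0 := by
  obtain ⟨a', hs, h⟩ := exists_similar_coeff_four a
  by_cases h2 : a' 2 2 = 0
  · exact ⟨a', hs, by simpa [h2] using h, h2⟩
  · -- This substitution sends infinity to the double root `-a' 2 1 / (2 * a' 2 2)`.
    refine ⟨_, hs.trans (similar_mul_symSq a' (g := !![0, 1; -1, -a' 2 1 / (2 * a' 2 2)])
      (by simp [Matrix.det_fin_two])), ?_, ?_⟩
    · simp [symSq, Matrix.mul_apply, Fin.sum_univ_three]
      field_simp
      ring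
    · simp [symSq, Matrix.mul_apply, Fin.sum_univ_three]
      field_simp
      linear_combination -h

/-- With `(∞, ∞)` a branch point of the first projection, scaling and a shift of `x` lead to the
normal form; the entries to be scaled are nonzero because the discriminant is. -/
theorem exists_similar_tateForm {a : Matrix (Fin 3) (Fin 3) ℂ} (hF : invF a ≠ 0) :
    ∃ a₁ b e c, Similar a (tateForm a₁ b e c) := by
  obtain ⟨a', hs, h1, h2⟩ := exists_similar_corner a
  have hF' := hs.invF_ne_zero hF
  obtain ⟨-, -, -, h3, h4⟩ := coeff_discrY a'
  have hp : a' 1 2 ≠ 0 := by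
    intro h
    refine hF' (invF_eq_zero_of_coeff ?_ ?_)
    · rw [h3, h, h1, h2]; ring
    · rw [h4, h1, h2]; ring
  have hq : a' 2 0 ≠ 0 := by
    intro h
    refine hF' (invF_eq_zero_of_coeff ?_ ?_)
    · rw [h3, h, h1, h2]; ring
    · rw [h4, h1, h2]; ring
  obtain ⟨β, hβ⟩ := IsAlgClosed.exists_pow_nat_eq (-(a' 2 0)⁻¹) (n := 2) two_pos
  have hβ0 : β ≠ 0 := by
    rintro rfl
    simp [hq] at hβ
  have hβ' : β ^ 2 * a' 2 0 = -1 := by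
    rw [hβ]
    field_simp
  set α := (β * a' 1 2)⁻¹ with hα
  have hα0 : α ≠ 0 := by simp [hα, hβ0, hp]
  have hα' : α * β * a' 1 2 = 1 := by
    rw [hα]
    field_simp
  -- The scalings `α`, `β` normalize the entries `x y²` and `x²`, the shift `τ` removes `y²`.
  set τ := -α * a' 0 2 / a' 1 2 with hτ
  have hτ' : τ * a' 1 2 = -α * a' 0 2 := by
    rw [hτ]
    field_simp
  have hdet : (!![α, 0; τ, β]).det ≠ 0 := by simp [Matrix.det_fin_two, hα0, hβ0]
  have hs' := hs.trans (similar_symSq_mul a' hdet)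
  set A := symSq !![α, 0; τ, β] * a' with hA
  have hA' : ∀ i j, A i j = symSq !![α, 0; τ, β] i 0 * a' 0 j + symSq !![α, 0; τ, β] i 1 * a' 1 j
      + symSq !![α, 0; τ, β] i 2 * a' 2 j := fun i j => by
    rw [hA, Matrix.mul_apply, Fin.sum_univ_three]
  refine ⟨A 1 1, -A 1 0, A 0 1, -A 0 0, ?_⟩
  have : A = tateForm (A 1 1) (-A 1 0) (A 0 1) (-A 0 0) := by
    ext i j
    fin_cases i <;> fin_cases j <;> simp [tateForm]
    · rw [hA']
      simp [symSq, h2]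
      linear_combination α * hτ'
    · rw [hA']
      simp [symSq, h2]
      linear_combination hα'
    · rw [hA']
      simp [symSq]
      linear_combination hβ'
    · rw [hA']
      simp [symSq, h1]
    · rw [hA']
      simp [symSq, h2]
  rwa [← this]

theorem ptY_tateForm (a₁ b e c : ℂ) : ptY (tateForm a₁ b e c) = -e := by
  simp [ptY, tateForm, Matrix.det_fin_three]

theorem ptX_tateForm (a₁ b e c : ℂ) : ptX (tateForm a₁ b e c) = (a₁ ^ 2 + 4 * b) / 12 := by
  simp [ptX, tateForm]

theorem invD_tateForm (a₁ b e c : ℂ) :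
    invD (tateForm a₁ b e c) = (a₁ ^ 2 + 4 * b) ^ 2 / 12 - 4 * c - 2 * a₁ * e := by
  obtain ⟨y0, y1, y2, y3, y4⟩ := coeff_discrY (tateForm a₁ b e c)
  simp only [invD, eisensteinD, y0, y1, y2, y3, y4]
  simp [tateForm]
  ring

/-- If `e ≠ 0`, a shift of `y` makes the normal form vanish at the origin. -/
theorem similar_tateForm_zero (a₁ b c : ℂ) {e : ℂ} (he : e ≠ 0) :
    ∃ a₁' b', Similar (tateForm a₁ b e c) (tateForm a₁' b' e 0) := by
  have h := similar_mul_symSq (tateForm a₁ b e c) (g := !![1, 0; c / e, 1])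
    (by simp [Matrix.det_fin_two])
  refine ⟨a₁ + 2 * (c / e), b - a₁ * (c / e) - (c / e) ^ 2, ?_⟩
  convert h using 1
  ext i j
  fin_cases i <;> fin_cases j <;>
    simp [tateForm, symSq, Matrix.mul_apply, Fin.sum_univ_three] <;> field_simp <;> ring

/-! ### The group law on the normal form -/

open WeierstrassCurve.Affine

/-- The Weierstrass cubic `y² + a₁ x y + e y = x³ + b x² + c x`, which contains the origin. -/
def tateCurve (a₁ b e c : ℂ) : WeierstrassCurve.Affine ℂ := ⟨a₁, b, e, c, 0⟩

theorem form_tateForm (a₁ b e c : ℂ) (u w : Fin 2 → ℂ) :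
    form (tateForm a₁ b e c) u w = u 1 * u 0 * w 1 ^ 2 + (a₁ * u 1 + e * u 0) * u 0 * w 1 * w 0
      - (u 1 ^ 2 + b * u 1 * u 0 + c * u 0 ^ 2) * w 0 ^ 2 := by
  simp [form, tateForm, Fin.sum_univ_three]
  ring

theorem invF_tateForm (a₁ b e c : ℂ) :
    invF (tateForm a₁ b e c) = 256 * (tateCurve a₁ b e c).Δ := by
  simp only [invF, invE_eq, ptX_tateForm, ptY_tateForm, invD_tateForm, WeierstrassCurve.Δ,
    WeierstrassCurve.b₂, WeierstrassCurve.b₄, WeierstrassCurve.b₆, WeierstrassCurve.b₈, tateCurve]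
  ring

variable {a₁ b e c : ℂ}

theorem equation_tateCurve {x y : ℂ} (h : (tateCurve a₁ b e c).Nonsingular x y) :
    y ^ 2 + a₁ * x * y + e * y = x ^ 3 + b * x ^ 2 + c * x := by
  have := ((tateCurve a₁ b e c).equation_iff x y).1 h.1
  simpa [tateCurve] using this

theorem nonsingular_tateCurve (hF : invF (tateForm a₁ b e c) ≠ 0) {x y : ℂ}
    (h : y ^ 2 + a₁ * x * y + e * y = x ^ 3 + b * x ^ 2 + c * x) :
    (tateCurve a₁ b e c).Nonsingular x y := by
  refine (equation_iff_nonsingular_of_Δ_ne_zero ?_).1 ?_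
  · intro h0
    exact hF (by rw [invF_tateForm, h0, mul_zero])
  · rw [equation_iff]
    simpa [tateCurve] using h

theorem e_ne_zero_or_c_ne_zero (h : (tateCurve a₁ b e c).Nonsingular 0 0) : e ≠ 0 ∨ c ≠ 0 := by
  have := ((tateCurve a₁ b e c).nonsingular_iff' 0 0).1 h
  simp [tateCurve] at this
  tauto

/-- Homogeneous coordinates of the abscissa of a point of the cubic. -/
def fstCoord : (tateCurve a₁ b e c).Point → Fin 2 → ℂ
  | .zero => ![0, 1]
  | .some x _ _ => ![1, x]

open Classical in
/-- Homogeneous coordinates of the slope `y / x` of the line joining a point of the cubic to the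
origin; at the origin this is the slope `c / e` of the tangent. -/
noncomputable def sndCoord : (tateCurve a₁ b e c).Point → Fin 2 → ℂ
  | .zero => ![0, 1]
  | .some x y _ => if x = 0 ∧ y = 0 then ![e, c] else ![x, y]

theorem fstCoord_zero : fstCoord (0 : (tateCurve a₁ b e c).Point) = ![0, 1] := rfl

theorem fstCoord_some {x y : ℂ} (h : (tateCurve a₁ b e c).Nonsingular x y) :
    fstCoord (.some x y h) = ![1, x] := rfl

theorem sndCoord_zero : sndCoord (0 : (tateCurve a₁ b e c).Point) = ![0, 1] := rfl

theorem sndCoord_some {x y : ℂ} (h : (tateCurve a₁ b e c).Nonsingular x y) (hxy : x ≠ 0 ∨ y ≠ 0) :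
    sndCoord (.some x y h) = ![x, y] :=
  if_neg (by tauto)

theorem sndCoord_origin {x y : ℂ} (h : (tateCurve a₁ b e c).Nonsingular x y) (hx : x = 0)
    (hy : y = 0) : sndCoord (.some x y h) = ![e, c] :=
  if_pos ⟨hx, hy⟩

theorem vec_ne_zero {s t : ℂ} (h : s ≠ 0 ∨ t ≠ 0) : (![s, t] : Fin 2 → ℂ) ≠ 0 := fun h0 => by
  have h1 := congrFun h0 0
  have h2 := congrFun h0 1
  simp at h1 h2
  tauto

theorem fstCoord_ne_zero (P : (tateCurve a₁ b e c).Point) : fstCoord P ≠ 0 := by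
  cases P with
  | zero => exact vec_ne_zero (by simp)
  | some x y h => exact vec_ne_zero (by simp)

theorem sndCoord_ne_zero (P : (tateCurve a₁ b e c).Point) : sndCoord P ≠ 0 := by
  cases P with
  | zero => exact vec_ne_zero (by simp)
  | some x y h =>
    by_cases hxy : x = 0 ∧ y = 0
    · obtain ⟨rfl, rfl⟩ := hxy
      rw [sndCoord_origin h rfl rfl]
      exact vec_ne_zero (e_ne_zero_or_c_ne_zero h)
    · have : x ≠ 0 ∨ y ≠ 0 := by tauto
      rw [sndCoord_some h this]
      exact vec_ne_zero this

/-- The parametrization of the biquadratic curve in normal form by the cubic. -/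
noncomputable def toCurve (P : (tateCurve a₁ b e c).Point) : curve (tateForm a₁ b e c) :=
  ⟨(Projectivization.mk ℂ _ (fstCoord_ne_zero P), Projectivization.mk ℂ _ (sndCoord_ne_zero P)), by
    rw [mk_mem_curve, form_tateForm]
    cases P with
    | zero => simp [sndCoord, fstCoord]
    | some x y h =>
      have he := equation_tateCurve h
      by_cases hxy : x = 0 ∧ y = 0
      · obtain ⟨rfl, rfl⟩ := hxy
        rw [sndCoord_origin h rfl rfl, fstCoord_some]
        simp
        ring
      · rw [sndCoord_some h (by tauto), fstCoord_some]
        simp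
        linear_combination x * he⟩

theorem verticalSwitch_toCurve_eq {P P' : (tateCurve a₁ b e c).Point}
    (hx : fstCoord P' = fstCoord P) {k : ℂ} (hk : k ≠ 0)
    (h : ∀ z, form (tateForm a₁ b e c) (fstCoord P) z =
      k * bracket z (sndCoord P) * bracket z (sndCoord P')) :
    verticalSwitch _ (toCurve P) = toCurve P' :=
  verticalSwitch_eq (fstCoord_ne_zero P) (sndCoord_ne_zero P) (sndCoord_ne_zero P') rfl
    (Prod.ext (by simp [toCurve, hx]) rfl) hk h

theorem horizontalSwitch_toCurve_eq {P P' : (tateCurve a₁ b e c).Point} {r : ℂ}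
    (hy : r • sndCoord P = sndCoord P')
    {k : ℂ} (hk : k ≠ 0) (h : ∀ z, form (tateForm a₁ b e c) z (sndCoord P) =
      k * bracket z (fstCoord P) * bracket z (fstCoord P')) :
    horizontalSwitch _ (toCurve P) = toCurve P' :=
  horizontalSwitch_eq (fstCoord_ne_zero P) (fstCoord_ne_zero P') (sndCoord_ne_zero P) rfl
    (Prod.ext rfl ((Projectivization.mk_eq_mk_iff' ℂ _ _ _ _).2 ⟨r, hy⟩)) hk h

theorem neg_some_tateCurve {x y : ℂ} (h : (tateCurve a₁ b e c).Nonsingular x y) :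
    ∃ h', -(Point.some x y h) = Point.some x (-y - a₁ * x - e) h' :=
  ⟨(nonsingular_neg x y).mpr h, rfl⟩

/-- Since `(x, y)` and `-(x, y)` have the same abscissa, the vertical switch is negation. -/
theorem verticalSwitch_toCurve (P : (tateCurve a₁ b e c).Point) :
    verticalSwitch _ (toCurve P) = toCurve (-P) := by
  cases P with
  | zero =>
    refine verticalSwitch_toCurve_eq rfl (k := -1) (by simp) fun z => ?_
    change _ = -1 * bracket z ![0, 1] * bracket z ![0, 1]
    rw [form_tateForm]
    simp [fstCoord, bracket]
    ring
  | some x y h =>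
    have he := equation_tateCurve h
    obtain ⟨h', hn⟩ := neg_some_tateCurve h
    rw [hn]
    by_cases hx : x = 0
    · subst hx
      have hy : y * (y + e) = 0 := by linear_combination he
      by_cases he0 : e = 0
      · have hy0 : y = 0 := by simpa [he0] using hy
        subst hy0
        have hc : c ≠ 0 := (e_ne_zero_or_c_ne_zero h).resolve_left (by simpa using he0)
        refine verticalSwitch_toCurve_eq rfl (k := -c⁻¹) (by simp [hc]) fun z => ?_
        rw [sndCoord_origin h rfl rfl, sndCoord_origin h' rfl (by simp [he0]), form_tateForm,
          fstCoord_some]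
        simp [bracket, he0]
        field_simp
      · rcases mul_eq_zero.1 hy with hy0 | hy0
        · subst hy0
          refine verticalSwitch_toCurve_eq rfl (k := e⁻¹) (by simp [he0]) fun z => ?_
          rw [sndCoord_origin h rfl rfl, sndCoord_some h' (by simp [he0]), form_tateForm,
            fstCoord_some]
          simp [bracket]
          field_simp
          ring
        · have hy1 : y = -e := by linear_combination hy0
          subst hy1
          refine verticalSwitch_toCurve_eq rfl (k := e⁻¹) (by simp [he0]) fun z => ?_
          rw [sndCoord_some h (by simp [he0]), sndCoord_origin h' rfl (by simp), form_tateForm,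
            fstCoord_some]
          simp [bracket]
          field_simp
          ring
    · refine verticalSwitch_toCurve_eq rfl (k := x⁻¹) (by simp [hx]) fun z => ?_
      rw [sndCoord_some h (Or.inl hx), sndCoord_some h' (Or.inl hx), form_tateForm, fstCoord_some]
      simp [bracket]
      field_simp
      linear_combination z 0 ^ 2 * he

theorem origin_nonsingular (hF : invF (tateForm a₁ b e c) ≠ 0) :
    (tateCurve a₁ b e c).Nonsingular 0 0 :=
  nonsingular_tateCurve hF (by ring)

/-- The switch of the points of slope `ℓ`: the abscissas `x`, `x'` of two points on a line through
the origin have sum `ℓ² + a₁ ℓ - b`. -/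
theorem horizontalSwitch_toCurve_slope {P : (tateCurve a₁ b e c).Point} {x x' y' ℓ k : ℂ}
    (hk : k ≠ 0) (hP1 : fstCoord P = ![1, x]) (hP2 : sndCoord P = ![k, k * ℓ])
    (h' : (tateCurve a₁ b e c).Nonsingular x' y') (hx' : x' = ℓ ^ 2 + a₁ * ℓ - b - x)
    (hy' : y' = ℓ * x') (hxx : x * x' = c - e * ℓ) :
    horizontalSwitch _ (toCurve P) = toCurve (.some x' y' h') := by
  -- If `x' = 0`, the second point is the origin, whose slope has coordinates `[e : c] = [e : e ℓ]`.
  refine horizontalSwitch_toCurve_eq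
    (r := if x' = 0 then e / k else x' / k) (k := -k ^ 2) ?_ (by simp [hk]) fun z => ?_
  · rw [hP2]
    split_ifs with h0
    · rw [sndCoord_origin h' h0 (by rw [hy', h0, mul_zero])]
      have : c = e * ℓ := by rw [h0] at hxx; linear_combination -hxx
      ext i
      fin_cases i
      · simp [hk]
      · simp [this]
        field_simp
    · rw [sndCoord_some h' (Or.inl h0), hy']
      ext i
      fin_cases i
      · simp [hk]
      · simp
        field_simp
  · rw [hP1, hP2, form_tateForm, fstCoord_some]
    simp [bracket]
    linear_combination (k ^ 2 * z 0 ^ 2) * hxx + (-k ^ 2 * z 0 * z 1) * hx'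

/-- Points with the same slope are collinear with the origin `Q`, so the horizontal switch is
`P ↦ -(Q + P)`. -/
theorem horizontalSwitch_toCurve (hQ : (tateCurve a₁ b e c).Nonsingular 0 0)
    (P : (tateCurve a₁ b e c).Point) :
    horizontalSwitch _ (toCurve P) = toCurve (-(.some 0 0 hQ + P)) := by
  have hzero : horizontalSwitch _ (toCurve (0 : (tateCurve a₁ b e c).Point)) =
      toCurve (-(.some 0 0 hQ)) := by
    obtain ⟨h', hn⟩ := neg_some_tateCurve hQ
    rw [hn]
    refine horizontalSwitch_toCurve_eq (r := if e = 0 then c else -e) (k := -1) ?_ (by simp)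
      fun z => ?_
    · rw [sndCoord_zero]
      split_ifs with h0
      · rw [sndCoord_origin h' rfl (by simp [h0]), h0]
        simp
      · rw [sndCoord_some h' (Or.inr (by simpa using h0))]
        simp
    · rw [sndCoord_zero, fstCoord_zero, fstCoord_some, form_tateForm]
      simp [bracket]
      ring
  cases P with
  | zero =>
    change horizontalSwitch _ (toCurve 0) = toCurve (-(_ + 0))
    rw [add_zero, hzero]
  | some x y h =>
    have he := equation_tateCurve h
    by_cases hx : x = 0
    · subst hx
      have hy : y * (y + e) = 0 := by linear_combination he
      by_cases hye : y + e = 0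
      · have hP : Point.some 0 y h = -(Point.some 0 0 hQ) := by
          rw [Point.neg_some, Point.some.injEq]
          exact ⟨rfl, by simp [negY, tateCurve]; linear_combination hye⟩
        rw [hP, add_neg_cancel, neg_zero, ← hzero]
        exact Equiv.congr_fun (horizontalSwitch_mul_self _) _
      · have hy0 : y = 0 := (mul_eq_zero.1 hy).resolve_right hye
        subst hy0
        have he0 : e ≠ 0 := by simpa using hye
        have hY : (0 : ℂ) ≠ (tateCurve a₁ b e c).negY 0 0 := by
          simpa [negY, tateCurve] using he0
        have hsl : (tateCurve a₁ b e c).slope 0 0 0 0 = c / e := by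
          rw [slope_of_Y_ne rfl hY]
          simp [negY, tateCurve]
        rw [Point.add_self_of_Y_ne' hY, neg_neg]
        refine horizontalSwitch_toCurve_slope (ℓ := c / e) he0 (fstCoord_some h)
          (by rw [sndCoord_origin h rfl rfl]; congr; field_simp) _ ?_ ?_ ?_
        · rw [hsl]
          simp [addX, tateCurve]
        · simp [negAddY, hsl]
        · field_simp
          ring
    · have hsl : (tateCurve a₁ b e c).slope 0 x 0 y = y / x := by
        rw [slope_of_X_ne (Ne.symm hx)]
        simp [neg_div_neg_eq]
      rw [Point.add_of_X_ne' (Ne.symm hx), neg_neg]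
      refine horizontalSwitch_toCurve_slope (ℓ := y / x) hx (fstCoord_some h)
          (by rw [sndCoord_some h (Or.inl hx)]; congr; field_simp) _ ?_ ?_ ?_
      · rw [hsl]
        simp [addX, tateCurve]
      · simp [negAddY, hsl]
      · rw [hsl]
        simp [addX, tateCurve]
        field_simp
        linear_combination he

theorem toCurve_surjective (hF : invF (tateForm a₁ b e c) ≠ 0) :
    Function.Surjective (toCurve : (tateCurve a₁ b e c).Point → curve (tateForm a₁ b e c)) := by
  rintro ⟨⟨p, q⟩, hpq⟩
  induction p using Projectivization.ind with | h u hu => ?_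
  induction q using Projectivization.ind with | h w hw => ?_
  have hQ := e_ne_zero_or_c_ne_zero (origin_nonsingular hF)
  have key : ∀ P : (tateCurve a₁ b e c).Point, (∃ r : ℂ, r • u = fstCoord P) →
      (∃ r : ℂ, r • w = sndCoord P) → ∃ P, toCurve P =
        (⟨(Projectivization.mk ℂ u hu, Projectivization.mk ℂ w hw), hpq⟩ :
          curve (tateForm a₁ b e c)) := fun P h1 h2 =>
    ⟨P, Subtype.ext (Prod.ext ((Projectivization.mk_eq_mk_iff' ℂ _ _ _ _).2 h1)
      ((Projectivization.mk_eq_mk_iff' ℂ _ _ _ _).2 h2))⟩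
  have hinf : ∀ v : Fin 2 → ℂ, v ≠ 0 → v 0 = 0 → v 1 ≠ 0 := fun v hv h0 h1 => hv <| by
    ext i
    fin_cases i
    · exact h0
    · exact h1
  have hsmul : ∀ (r s t : ℂ) (v : Fin 2 → ℂ), r * v 0 = s → r * v 1 = t → r • v = ![s, t] := by
    rintro r s t v rfl rfl
    ext i
    fin_cases i <;> simp
  rw [mk_mem_curve, form_tateForm] at hpq
  by_cases hu0 : u 0 = 0
  · have hu1 := hinf u hu hu0
    have hw0 : w 0 = 0 := by simpa [hu0, hu1] using hpq
    have hw1 := hinf w hw hw0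
    exact key 0 ⟨(u 1)⁻¹, hsmul _ _ _ _ (by simp [hu0]) (by simp [hu1])⟩
      ⟨(w 1)⁻¹, hsmul _ _ _ _ (by simp [hw0]) (by simp [hw1])⟩
  · obtain ⟨x, hx⟩ : ∃ x, u 1 = x * u 0 := ⟨u 1 / u 0, by field_simp⟩
    have hfst : ∃ r : ℂ, r • u = ![1, x] :=
      ⟨(u 0)⁻¹, hsmul _ _ _ _ (by simp [hu0]) (by rw [hx]; field_simp)⟩
    have hpq' : x * w 1 ^ 2 + (a₁ * x + e) * w 1 * w 0 - (x ^ 2 + b * x + c) * w 0 ^ 2 = 0 := by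
      rw [hx] at hpq
      have : u 0 ^ 2 * (x * w 1 ^ 2 + (a₁ * x + e) * w 1 * w 0
          - (x ^ 2 + b * x + c) * w 0 ^ 2) = 0 := by linear_combination hpq
      exact (mul_eq_zero.1 this).resolve_left (pow_ne_zero 2 hu0)
    by_cases hw0 : w 0 = 0
    · have hw1 := hinf w hw hw0
      have hx0 : x = 0 := by simpa [hw0, hw1] using hpq'
      subst hx0
      have hns : (tateCurve a₁ b e c).Nonsingular 0 (-e) := nonsingular_tateCurve hF (by ring)
      refine key (.some 0 (-e) hns) hfst ?_
      by_cases he : e = 0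
      · refine ⟨c / w 1, ?_⟩
        rw [sndCoord_origin hns rfl (by simp [he])]
        exact hsmul _ _ _ _ (by simp [hw0, he]) (by field_simp)
      · refine ⟨-e / w 1, ?_⟩
        rw [sndCoord_some hns (by simp [he])]
        exact hsmul _ _ _ _ (by simp [hw0]) (by field_simp)
    · obtain ⟨y, hy⟩ : ∃ y, w 1 = y * w 0 := ⟨w 1 / w 0, by field_simp⟩
      have hxy : x * y ^ 2 + (a₁ * x + e) * y = x ^ 2 + b * x + c := by
        rw [hy] at hpq'
        have : w 0 ^ 2 * (x * y ^ 2 + (a₁ * x + e) * y - (x ^ 2 + b * x + c)) = 0 := by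
          linear_combination hpq'
        exact sub_eq_zero.1 ((mul_eq_zero.1 this).resolve_left (pow_ne_zero 2 hw0))
      have hns : (tateCurve a₁ b e c).Nonsingular x (x * y) :=
        nonsingular_tateCurve hF (by linear_combination x * hxy)
      refine key (.some x (x * y) hns) hfst ?_
      by_cases hx0 : x = 0
      · refine ⟨e / w 0, ?_⟩
        rw [sndCoord_origin hns hx0 (by simp [hx0])]
        refine hsmul _ _ _ _ (by field_simp) ?_
        rw [hy]
        field_simp
        rw [hx0] at hxy
        linear_combination hxy
      · refine ⟨x / w 0, ?_⟩
        rw [sndCoord_some hns (Or.inl hx0)]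
        exact hsmul _ _ _ _ (by field_simp) (by rw [hy]; field_simp)

/-- Only the point at infinity of the cubic has infinite abscissa. -/
theorem toCurve_eq_zero {P : (tateCurve a₁ b e c).Point} (h : toCurve P = toCurve 0) : P = 0 := by
  cases P with
  | zero => rfl
  | some x y hxy =>
    have h1 := congrArg (fun p => p.1.1) h
    obtain ⟨r, hr⟩ := (Projectivization.mk_eq_mk_iff' ℂ _ _ _ _).1 h1
    have := congrFun hr 0
    simp [fstCoord_zero, fstCoord_some] at this

/-- The composite of the two switches is the translation `P ↦ P - Q`, so its order is that of `Q`.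
For `T ^ n = 1 → n • Q = 0` only the fibre of the parametrization over the image of `0` matters. -/
theorem orderOf_tateForm (hF : invF (tateForm a₁ b e c) ≠ 0)
    (hQ : (tateCurve a₁ b e c).Nonsingular 0 0) :
    orderOf (horizontalSwitch (tateForm a₁ b e c) * verticalSwitch (tateForm a₁ b e c)) =
      addOrderOf (Point.some 0 0 hQ) := by
  set T := horizontalSwitch (tateForm a₁ b e c) * verticalSwitch (tateForm a₁ b e c)
  set Q := Point.some 0 0 hQ
  have hT : ∀ P, T (toCurve P) = toCurve (P - Q) := fun P => by
    change horizontalSwitch _ (verticalSwitch _ (toCurve P)) = _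
    rw [verticalSwitch_toCurve, horizontalSwitch_toCurve hQ]
    congr 1
    abel
  have hTn : ∀ (n : ℕ) P, (T ^ n) (toCurve P) = toCurve (P - n • Q) := by
    intro n
    induction n with
    | zero => simp
    | succ n ih =>
      intro P
      rw [pow_succ', Equiv.Perm.mul_apply, ih, hT, succ_nsmul, sub_sub]
  have hpow : ∀ n : ℕ, T ^ n = 1 ↔ n • Q = 0 := fun n => by
    constructor
    · intro h
      have h0 := hTn n 0
      rw [h, Equiv.Perm.one_apply, zero_sub] at h0
      exact neg_eq_zero.1 (toCurve_eq_zero h0.symm)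
    · intro h
      ext1 p
      obtain ⟨P, rfl⟩ := toCurve_surjective hF p
      rw [hTn, h, sub_zero, Equiv.Perm.one_apply]
  refine Nat.dvd_antisymm ?_ ?_
  · rw [orderOf_dvd_iff_pow_eq_one, hpow, addOrderOf_nsmul_eq_zero]
  · rw [addOrderOf_dvd_iff_nsmul_eq_zero, ← hpow, pow_orderOf_eq_one]

/-! ### Points of small order -/

theorem exists_some_eq {W : WeierstrassCurve.Affine ℂ} {x y x' y' : ℂ} (h : W.Nonsingular x y)
    (hx : x = x') (hy : y = y') : ∃ h', Point.some x y h = Point.some x' y' h' := by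
  subst hx hy
  exact ⟨h, rfl⟩

theorem two_nsmul_origin_eq_zero_iff (hQ : (tateCurve a₁ b e c).Nonsingular 0 0) :
    2 • Point.some 0 0 hQ = 0 ↔ e = 0 := by
  obtain ⟨h', hn⟩ := neg_some_tateCurve hQ
  rw [two_nsmul, add_eq_zero_iff_eq_neg, hn, Point.some.injEq]
  simp [eq_comm]

theorem two_nsmul_origin (hQ : (tateCurve a₁ b e 0).Nonsingular 0 0) (he : e ≠ 0) :
    ∃ h', 2 • Point.some 0 0 hQ = Point.some (-b) (a₁ * b - e) h' := by
  have hY : (0 : ℂ) ≠ (tateCurve a₁ b e 0).negY 0 0 := by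
    simpa [negY, tateCurve] using he
  have hsl : (tateCurve a₁ b e 0).slope 0 0 0 0 = 0 := by
    rw [slope_of_Y_ne rfl hY]
    simp [tateCurve]
  rw [two_nsmul, Point.add_self_of_Y_ne hY]
  refine exists_some_eq _ ?_ ?_
  · rw [hsl]
    simp [addX, tateCurve]
  · rw [hsl]
    simp [addY, negAddY, negY, addX, tateCurve]

theorem three_nsmul_origin (hQ : (tateCurve a₁ b e 0).Nonsingular 0 0) (he : e ≠ 0) (hb : b ≠ 0)
    {d : ℂ} (hd : e = d * b) :
    ∃ h', 3 • Point.some 0 0 hQ =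
      Point.some (d * (d - a₁)) (-d * (d * (d - a₁) + b)) h' := by
  obtain ⟨h2, hQ2⟩ := two_nsmul_origin hQ he
  have hX : -b ≠ 0 := neg_ne_zero.2 hb
  have hsl : (tateCurve a₁ b e 0).slope (-b) 0 (a₁ * b - e) 0 = d - a₁ := by
    rw [slope_of_X_ne hX, hd]
    field_simp
    ring
  rw [show 3 = 2 + 1 from rfl, succ_nsmul, hQ2, Point.add_of_X_ne hX]
  refine exists_some_eq _ ?_ ?_
  · rw [hsl]
    simp [addX, tateCurve]
    ring
  · rw [hsl]
    simp [addY, negAddY, negY, addX, tateCurve]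
    rw [hd]
    ring

theorem three_nsmul_origin_eq_zero_iff (hQ : (tateCurve a₁ b e 0).Nonsingular 0 0) (he : e ≠ 0) :
    3 • Point.some 0 0 hQ = 0 ↔ b = 0 := by
  obtain ⟨h2, hQ2⟩ := two_nsmul_origin hQ he
  obtain ⟨h', hn⟩ := neg_some_tateCurve hQ
  rw [show 3 = 2 + 1 from rfl, succ_nsmul, add_eq_zero_iff_eq_neg, hQ2, hn, Point.some.injEq]
  constructor
  · rintro ⟨h, -⟩
    exact neg_eq_zero.1 h
  · rintro rfl
    simp

theorem four_nsmul_origin_eq_zero_iff (hQ : (tateCurve a₁ b e 0).Nonsingular 0 0) (he : e ≠ 0) :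
    4 • Point.some 0 0 hQ = 0 ↔ e = a₁ * b := by
  obtain ⟨h2, hQ2⟩ := two_nsmul_origin hQ he
  obtain ⟨h', hn⟩ := neg_some_tateCurve h2
  rw [show 4 = 2 + 2 from rfl, add_nsmul, add_eq_zero_iff_eq_neg, hQ2, hn, Point.some.injEq]
  constructor
  · rintro ⟨-, h⟩
    linear_combination -h
  · rintro h
    exact ⟨rfl, by linear_combination -h⟩

theorem five_nsmul_origin_eq_zero_iff (hQ : (tateCurve a₁ b e 0).Nonsingular 0 0) (he : e ≠ 0) :
    5 • Point.some 0 0 hQ = 0 ↔ e * (e - a₁ * b) + b ^ 3 = 0 := by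
  obtain ⟨h2, hQ2⟩ := two_nsmul_origin hQ he
  by_cases hb : b = 0
  · rw [show 5 = 3 + 2 from rfl, add_nsmul, (three_nsmul_origin_eq_zero_iff hQ he).2 hb, zero_add,
      two_nsmul_origin_eq_zero_iff, hb]
    simp [he]
  · have hd : e = e / b * b := by field_simp
    obtain ⟨h3, hQ3⟩ := three_nsmul_origin hQ he hb hd
    obtain ⟨h', hn⟩ := neg_some_tateCurve h2
    rw [show 5 = 3 + 2 from rfl, add_nsmul, add_eq_zero_iff_eq_neg, hQ2, hQ3, hn, Point.some.injEq]
    set d := e / b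
    have hb2 : b ^ 2 ≠ 0 := pow_ne_zero 2 hb
    constructor
    · rintro ⟨h, -⟩
      rw [hd]
      linear_combination b ^ 2 * h
    · intro h
      have h1 : d * (d - a₁) = -b := by
        refine mul_left_cancel₀ hb2 ?_
        rw [hd] at h
        linear_combination h
      exact ⟨h1, by rw [h1]; ring⟩

theorem six_nsmul_origin_eq_zero_iff (hQ : (tateCurve a₁ b e 0).Nonsingular 0 0) (he : e ≠ 0)
    (hb : b ≠ 0) :
    6 • Point.some 0 0 hQ = 0 ↔ (2 * e - a₁ * b) * (e - a₁ * b) + b ^ 3 = 0 := by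
  obtain ⟨d, hd⟩ : ∃ d, e = d * b := ⟨e / b, by field_simp⟩
  have hd0 : d ≠ 0 := by
    rintro rfl
    exact he (by rw [hd, zero_mul])
  obtain ⟨h3, hQ3⟩ := three_nsmul_origin hQ he hb hd
  obtain ⟨h', hn⟩ := neg_some_tateCurve h3
  rw [show 6 = 3 + 3 from rfl, add_nsmul, add_eq_zero_iff_eq_neg, hQ3, hn, Point.some.injEq]
  constructor
  · rintro ⟨-, h⟩
    refine mul_left_cancel₀ hd0 ?_
    rw [hd] at h ⊢
    linear_combination (-b ^ 2) * h
  · intro h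
    refine ⟨rfl, mul_left_cancel₀ (pow_ne_zero 2 hb) ?_⟩
    rw [hd] at h ⊢
    linear_combination (-d) * h

theorem addOrderOf_eq_four_iff {G : Type*} [AddGroup G] {x : G} :
    addOrderOf x = 4 ↔ 4 • x = 0 ∧ 2 • x ≠ 0 := by
  constructor
  · intro h
    refine ⟨addOrderOf_dvd_iff_nsmul_eq_zero.1 (by rw [h]), fun h2 => ?_⟩
    have := addOrderOf_dvd_of_nsmul_eq_zero h2
    rw [h] at this
    omega
  · rintro ⟨h4, h2⟩
    exact addOrderOf_eq_prime_pow (p := 2) (n := 1) h2 h4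

theorem addOrderOf_eq_six_iff {G : Type*} [AddGroup G] {x : G} :
    addOrderOf x = 6 ↔ 6 • x = 0 ∧ 2 • x ≠ 0 ∧ 3 • x ≠ 0 := by
  constructor
  · intro h
    refine ⟨addOrderOf_dvd_iff_nsmul_eq_zero.1 (by rw [h]), fun h2 => ?_, fun h2 => ?_⟩ <;>
    · have := addOrderOf_dvd_of_nsmul_eq_zero h2
      rw [h] at this
      omega
  · rintro ⟨h6, h2, h3⟩
    refine addOrderOf_eq_of_nsmul_and_div_prime_nsmul (by norm_num) h6 fun p hp hd => ?_
    have : p ∣ 2 ∨ p ∣ 3 := hp.dvd_mul.1 (by simpa using hd)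
    rcases this with h | h
    · rw [(Nat.prime_dvd_prime_iff_eq hp Nat.prime_two).1 h]
      exact h3
    · rw [(Nat.prime_dvd_prime_iff_eq hp Nat.prime_three).1 h]
      exact h2

/-! ### The Taylor coefficients -/

/-- The square of the Taylor series of the branch is the Taylor series of the cubic. -/
theorem sum_taylorCoeff_mul (a : Matrix (Fin 3) (Fin 3) ℂ) (h : ptY a ≠ 0) (k : ℕ) :
    ∑ i ∈ Finset.range (k + 1), taylorCoeff a i * taylorCoeff a (k - i) =
      iteratedDeriv k (cubic a) (ptX a) / (k.factorial : ℂ) := by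
  have hs : cubic a = sqrtBranch a * sqrtBranch a := funext fun x => by
    rw [Pi.mul_apply, ← sq, sqrtBranch_sq a h]
  have hc : ContDiffAt ℂ (k : ℕ) (sqrtBranch a) (ptX a) := (sqrtBranch_analyticAt a h).contDiffAt
  rw [hs, iteratedDeriv_mul hc hc, Finset.sum_div]
  refine Finset.sum_congr rfl fun i hi => ?_
  have hik : i ≤ k := Nat.lt_succ_iff.1 (Finset.mem_range.1 hi)
  have hk := k.factorial_ne_zero
  have hi := i.factorial_ne_zero
  have hki := (k - i).factorial_ne_zero
  rw [Nat.cast_choose ℂ hik]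
  simp only [taylorCoeff]
  field_simp

theorem taylorCoeff_zero (a : Matrix (Fin 3) (Fin 3) ℂ) : taylorCoeff a 0 = ptY a := by
  simp [taylorCoeff, sqrtBranch_ptX]

/-- Comparison of the first coefficients in `(C₀ + C₁ t + ⋯)² = 4 x³ - D x + E`, `t = x - X`. -/
theorem taylorCoeff_relations (a : Matrix (Fin 3) (Fin 3) ℂ) (h : ptY a ≠ 0) :
    2 * ptY a * taylorCoeff a 1 = 12 * ptX a ^ 2 - invD a ∧
    2 * ptY a * taylorCoeff a 2 + taylorCoeff a 1 ^ 2 = 12 * ptX a ∧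
    ptY a * taylorCoeff a 3 + taylorCoeff a 1 * taylorCoeff a 2 = 2 ∧
    2 * ptY a * taylorCoeff a 4 + 2 * taylorCoeff a 1 * taylorCoeff a 3 + taylorCoeff a 2 ^ 2 = 0 ∧
    ptY a * taylorCoeff a 5 + taylorCoeff a 1 * taylorCoeff a 4
      + taylorCoeff a 2 * taylorCoeff a 3 = 0 := by
  have d1 : deriv (cubic a) = fun x => 12 * x ^ 2 - invD a := by
    ext x
    have : HasDerivAt (cubic a) (4 * (3 * x ^ 2 * 1) - invD a * 1) x :=
      (((((hasDerivAt_id x).pow 3).const_mul 4).sub ((hasDerivAt_id x).const_mul _)).add_const _)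
    rw [this.deriv]
    ring
  have d2 : deriv (fun x => 12 * x ^ 2 - invD a) = fun x => 24 * x := by
    ext x
    have : HasDerivAt (fun x => 12 * x ^ 2 - invD a) (12 * (2 * x ^ 1 * 1)) x :=
      (((hasDerivAt_id x).pow 2).const_mul 12).sub_const _
    rw [this.deriv]
    ring
  have d3 : deriv (fun x : ℂ => 24 * x) = fun _ => 24 := by
    ext x
    simp
  have d4 : deriv (fun _ : ℂ => (24 : ℂ)) = fun _ => 0 := by
    ext x
    simp
  have d5 : deriv (fun _ : ℂ => (0 : ℂ)) = fun _ => 0 := by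
    ext x
    simp
  have h1 := sum_taylorCoeff_mul a h 1
  have h2 := sum_taylorCoeff_mul a h 2
  have h3 := sum_taylorCoeff_mul a h 3
  have h4 := sum_taylorCoeff_mul a h 4
  have h5 := sum_taylorCoeff_mul a h 5
  simp only [iteratedDeriv_succ, iteratedDeriv_zero, d1, d2, d3, d4, d5, Finset.sum_range_succ,
    Finset.sum_range_zero, Nat.factorial, taylorCoeff_zero, Nat.reduceSub, zero_add, Nat.sub_zero,
    Nat.reduceAdd, Nat.sub_self] at h1 h2 h3 h4 h5
  norm_num at h1 h2 h3 h4 h5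
  refine ⟨?_, ?_, ?_, ?_, ?_⟩
  · linear_combination h1
  · linear_combination h2
  · linear_combination h3 / 2
  · linear_combination h4
  · linear_combination h5 / 2

theorem taylorCoeff_formulas (a : Matrix (Fin 3) (Fin 3) ℂ) {D E X S : ℂ} (hS0 : S ≠ 0)
    (hD : D = invD a) (hE : E = S ^ 2 - 4 * X ^ 3 + D * X) (hX : X = ptX a) (hS : S = ptY a) :
    taylorCoeff a 2 =
        (-D ^ 2 - 24 * D * X ^ 2 + 48 * E * X + 48 * X ^ 4) / (8 * S ^ 3) ∧
    taylorCoeff a 3 =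
        (-D ^ 3 + 20 * D ^ 2 * X ^ 2 - 16 * D * E * X + 80 * D * X ^ 4 + 32 * E ^ 2
          - 320 * E * X ^ 3 - 64 * X ^ 6) / (16 * S ^ 5) ∧
    taylorCoeff a 4 =
        (-5 * D ^ 4 + 80 * D ^ 3 * X ^ 2 + 32 * D ^ 2 * E * X - 1120 * D ^ 2 * X ^ 4
          + 128 * D * E ^ 2 + 1792 * D * E * X ^ 3 - 1792 * D * X ^ 6 - 3840 * E ^ 2 * X ^ 2
          + 10752 * E * X ^ 5 + 768 * X ^ 8) / (128 * S ^ 7) ∧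
    taylorCoeff a 5 =
        (-7 * D ^ 5 + 132 * D ^ 4 * X ^ 2 + 96 * D ^ 3 * X * (E - 9 * X ^ 3)
          + 192 * D ^ 2 * (E ^ 2 - 10 * E * X ^ 3 + 70 * X ^ 6)
          - 2304 * D * X ^ 2 * (E ^ 2 + 14 * E * X ^ 3 - 5 * X ^ 6)
          - 3072 * X * (E ^ 3 - 24 * E ^ 2 * X ^ 3 + 30 * E * X ^ 6 + X ^ 9))
          / (256 * S ^ 9) := by
  obtain ⟨r1, r2, r3, r4, r5⟩ := taylorCoeff_relations a (hS ▸ hS0)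
  rw [← hS, ← hX, ← hD] at r1
  rw [← hS, ← hX] at r2
  rw [← hS] at r3 r4 r5
  generalize taylorCoeff a 1 = C₁ at *
  generalize taylorCoeff a 2 = C₂ at *
  generalize taylorCoeff a 3 = C₃ at *
  generalize taylorCoeff a 4 = C₄ at *
  generalize taylorCoeff a 5 = C₅ at *
  have e1 : C₁ = (12 * X ^ 2 - D) / (2 * S) := by
    field_simp
    linear_combination r1
  have e2 : C₂ = (12 * X - C₁ ^ 2) / (2 * S) := by
    field_simp
    linear_combination r2
  have e3 : C₃ = (2 - C₁ * C₂) / S := by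
    field_simp
    linear_combination r3
  have e4 : C₄ = -(2 * C₁ * C₃ + C₂ ^ 2) / (2 * S) := by
    field_simp
    linear_combination r4
  have e5 : C₅ = -(C₁ * C₄ + C₂ * C₃) / S := by
    field_simp
    linear_combination r5
  subst hE
  have f2 : C₂ = (-D ^ 2 - 24 * D * X ^ 2 + 48 * (S ^ 2 - 4 * X ^ 3 + D * X) * X + 48 * X ^ 4)
      / (8 * S ^ 3) := by
    rw [e2, e1]
    field_simp
    ring
  refine ⟨f2, ?_, ?_, ?_⟩
  · rw [e3, f2, e1]
    field_simp
    ring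
  · rw [e4, e3, f2, e1]
    field_simp
    ring
  · rw [e5, e4, e3, f2, e1]
    field_simp
    ring

/-! ### The order of the walk group -/

/-- Order two is read off the normal form without the shift of `y`, which needs `e ≠ 0`: there
`2 • Q = 0` means `e = 0`, and the determinant is `-e`. -/
theorem orderOf_eq_two_iff {a : Matrix (Fin 3) (Fin 3) ℂ} (hF : invF a ≠ 0) :
    orderOf (horizontalSwitch a * verticalSwitch a) = 2 ↔ ptY a = 0 := by
  obtain ⟨a₁, b, e, c, hs⟩ := exists_similar_tateForm hF
  have hF' := hs.invF_ne_zero hF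
  have hQ := origin_nonsingular hF'
  obtain ⟨δ, hδ, -, -, hY, ho⟩ := hs
  rw [← ho, orderOf_tateForm hF' hQ, addOrderOf_eq_prime_iff, two_nsmul_origin_eq_zero_iff,
    and_iff_left (WeierstrassCurve.Affine.Point.some_ne_zero hQ)]
  rw [ptY_tateForm] at hY
  rw [← neg_eq_zero, hY]
  simp [hδ]

/-- The criteria for orders `3`, `4`, `5`, `6`, by comparison of the conditions on the multiples of
the origin of the cubic with the Taylor coefficients, both in terms of the normal form. -/
theorem orderOf_iff_taylorCoeff {a : Matrix (Fin 3) (Fin 3) ℂ} (hF : invF a ≠ 0)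
    (h0 : ptY a ≠ 0) :
    (orderOf (horizontalSwitch a * verticalSwitch a) = 3 ↔ taylorCoeff a 2 = 0) ∧
    (orderOf (horizontalSwitch a * verticalSwitch a) = 4 ↔ taylorCoeff a 3 = 0) ∧
    (orderOf (horizontalSwitch a * verticalSwitch a) = 5 ↔
      taylorCoeff a 3 ^ 2 = taylorCoeff a 2 * taylorCoeff a 4) ∧
    (orderOf (horizontalSwitch a * verticalSwitch a) = 6 ↔
      taylorCoeff a 4 ^ 2 = taylorCoeff a 3 * taylorCoeff a 5 ∧ taylorCoeff a 2 ≠ 0) := by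
  obtain ⟨a₁', b', e, c, hs'⟩ := exists_similar_tateForm hF
  have he : e ≠ 0 := by
    obtain ⟨δ, hδ, -, -, hY, -⟩ := hs'
    rw [ptY_tateForm] at hY
    rw [← neg_ne_zero, hY]
    exact mul_ne_zero (pow_ne_zero 3 hδ) h0
  obtain ⟨a₁, b, hs''⟩ := similar_tateForm_zero a₁' b' c he
  have hs := hs'.trans hs''
  have hF' := hs.invF_ne_zero hF
  have hQ := origin_nonsingular hF'
  obtain ⟨δ, hδ, hD, hX, hY, ho⟩ := hs
  rw [← ho, orderOf_tateForm hF' hQ]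
  rw [ptY_tateForm] at hY
  rw [ptX_tateForm] at hX
  rw [invD_tateForm] at hD
  obtain ⟨r1, r2, r3, r4, r5⟩ := taylorCoeff_relations a h0
  generalize taylorCoeff a 1 = C₁ at *
  generalize taylorCoeff a 2 = C₂ at *
  generalize taylorCoeff a 3 = C₃ at *
  generalize taylorCoeff a 4 = C₄ at *
  generalize taylorCoeff a 5 = C₅ at *
  have hY' : ptY a = -e / δ ^ 3 := by
    rw [hY]
    field_simp
  have hX' : ptX a = (a₁ ^ 2 + 4 * b) / 12 / δ ^ 2 := by
    rw [hX]
    field_simp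
  have hD' : invD a = ((a₁ ^ 2 + 4 * b) ^ 2 / 12 - 4 * 0 - 2 * a₁ * e) / δ ^ 4 := by
    rw [hD]
    field_simp
  rw [hY', hX', hD'] at r1
  rw [hY', hX'] at r2
  rw [hY'] at r3 r4 r5
  -- In the normal form `4 x³ - D x + E` becomes `4 x³ + (a₁² + 4 b) x² + 2 a₁ e x + e²` after a
  -- shift of `x`; here its coefficients enter through the relations for `a`, with powers of `δ`.
  have e1 : C₁ = -a₁ / δ := by
    field_simp at r1 ⊢
    refine mul_left_cancel₀ he ?_
    linear_combination -r1 / 24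
  have e2 : C₂ = -(2 * b) * δ / e := by
    rw [e1] at r2
    field_simp at r2 ⊢
    linear_combination -r2 / 2
  have e3 : C₃ = -(2 * (e - a₁ * b)) * δ ^ 3 / e ^ 2 := by
    rw [e1, e2] at r3
    field_simp at r3 ⊢
    linear_combination -r3
  have e4 : C₄ = (2 * (a₁ * (e - a₁ * b) + b ^ 2)) * δ ^ 5 / e ^ 3 := by
    rw [e1, e2, e3] at r4
    field_simp at r4 ⊢
    linear_combination -r4 / 2
  have e5 : C₅ = (4 * b * (e - a₁ * b) - 2 * a₁ * (a₁ * (e - a₁ * b) + b ^ 2)) * δ ^ 7 / e ^ 4 := by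
    rw [e1, e2, e3, e4] at r5
    field_simp at r5 ⊢
    linear_combination -r5
  have hQ0 := WeierstrassCurve.Affine.Point.some_ne_zero hQ
  have h2 : C₂ = 0 ↔ b = 0 := by
    rw [e2]
    simp [hδ, he]
  have hQ2 : 2 • WeierstrassCurve.Affine.Point.some 0 0 hQ ≠ 0 := fun h =>
    he ((two_nsmul_origin_eq_zero_iff hQ).1 h)
  have : Fact (Nat.Prime 5) := ⟨Nat.prime_five⟩
  refine ⟨?_, ?_, ?_, ?_⟩
  · rw [addOrderOf_eq_prime_iff, and_iff_left hQ0, three_nsmul_origin_eq_zero_iff hQ he, h2]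
  · rw [addOrderOf_eq_four_iff, and_iff_left hQ2, four_nsmul_origin_eq_zero_iff hQ he, e3]
    simp [hδ, he, sub_eq_zero]
  · rw [addOrderOf_eq_prime_iff, and_iff_left hQ0, five_nsmul_origin_eq_zero_iff hQ he,
      ← sub_eq_zero (a := C₃ ^ 2)]
    have : C₃ ^ 2 - C₂ * C₄ = 4 * δ ^ 6 / e ^ 4 * (e * (e - a₁ * b) + b ^ 3) := by
      rw [e2, e3, e4]
      field_simp
      ring
    rw [this]
    simp [hδ, he]
  · rw [addOrderOf_eq_six_iff, and_iff_right hQ2, Ne, Ne, three_nsmul_origin_eq_zero_iff hQ he, h2]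
    refine and_congr_left fun hb => ?_
    rw [six_nsmul_origin_eq_zero_iff hQ he hb, ← sub_eq_zero (a := C₄ ^ 2)]
    have : C₄ ^ 2 - C₃ * C₅ = 4 * b * δ ^ 10 / e ^ 6 *
        ((2 * e - a₁ * b) * (e - a₁ * b) + b ^ 3) := by
      rw [e3, e4, e5]
      field_simp
      ring
    rw [this]
    simp [hδ, he, hb]

end Biquadratic

theorem mainTheorem2 (a : Matrix (Fin 3) (Fin 3) ℂ) (hF : Biquadratic.invF a ≠ 0) :
    (Nat.card (Biquadratic.walkGroup a) = 4 ↔ a.det = 0) ∧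
    (Nat.card (Biquadratic.walkGroup a) = 6 ↔
      a.det ≠ 0 ∧ Biquadratic.taylorCoeff a 2 = 0) ∧
    (Nat.card (Biquadratic.walkGroup a) = 8 ↔
      a.det ≠ 0 ∧ Biquadratic.taylorCoeff a 3 = 0) ∧
    (Nat.card (Biquadratic.walkGroup a) = 10 ↔
      a.det ≠ 0 ∧ Biquadratic.taylorCoeff a 3 ^ 2 =
        Biquadratic.taylorCoeff a 2 * Biquadratic.taylorCoeff a 4) ∧
    (Nat.card (Biquadratic.walkGroup a) = 12 ↔
      a.det ≠ 0 ∧ Biquadratic.taylorCoeff a 4 ^ 2 =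
        Biquadratic.taylorCoeff a 3 * Biquadratic.taylorCoeff a 5 ∧
      Biquadratic.taylorCoeff a 2 ≠ 0) ∧
    (a.det ≠ 0 → ∀ D E X S : ℂ, D = Biquadratic.invD a → E = Biquadratic.invE a →
      X = Biquadratic.ptX a → S = Biquadratic.sqrtBranch a X →
      S ^ 2 = 4 * X ^ 3 - D * X + E ∧
      S = a.det ∧
      Biquadratic.taylorCoeff a 2 =
        (-D ^ 2 - 24 * D * X ^ 2 + 48 * E * X + 48 * X ^ 4) / (8 * S ^ 3) ∧
      Biquadratic.taylorCoeff a 3 =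
        (-D ^ 3 + 20 * D ^ 2 * X ^ 2 - 16 * D * E * X + 80 * D * X ^ 4 + 32 * E ^ 2
          - 320 * E * X ^ 3 - 64 * X ^ 6) / (16 * S ^ 5) ∧
      Biquadratic.taylorCoeff a 4 =
        (-5 * D ^ 4 + 80 * D ^ 3 * X ^ 2 + 32 * D ^ 2 * E * X - 1120 * D ^ 2 * X ^ 4
          + 128 * D * E ^ 2 + 1792 * D * E * X ^ 3 - 1792 * D * X ^ 6 - 3840 * E ^ 2 * X ^ 2
          + 10752 * E * X ^ 5 + 768 * X ^ 8) / (128 * S ^ 7) ∧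
      Biquadratic.taylorCoeff a 5 =
        (-7 * D ^ 5 + 132 * D ^ 4 * X ^ 2 + 96 * D ^ 3 * X * (E - 9 * X ^ 3)
          + 192 * D ^ 2 * (E ^ 2 - 10 * E * X ^ 3 + 70 * X ^ 6)
          - 2304 * D * X ^ 2 * (E ^ 2 + 14 * E * X ^ 3 - 5 * X ^ 6)
          - 3072 * X * (E ^ 3 - 24 * E ^ 2 * X ^ 3 + 30 * E * X ^ 6 + X ^ 9))
          / (256 * S ^ 9)) := by
  obtain ⟨h3, h4, h5, h6⟩ : _ ∧ _ ∧ _ ∧ _ := ⟨fun h => (Biquadratic.orderOf_iff_taylorCoeff hF h).1,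
    fun h => (Biquadratic.orderOf_iff_taylorCoeff hF h).2.1,
    fun h => (Biquadratic.orderOf_iff_taylorCoeff hF h).2.2.1,
    fun h => (Biquadratic.orderOf_iff_taylorCoeff hF h).2.2.2⟩
  have h2 := Biquadratic.orderOf_eq_two_iff hF
  rw [Biquadratic.card_walkGroup hF]
  change _ ↔ a.det = 0 at h2
  change ∀ h : a.det ≠ 0, _ at h3 h4 h5 h6
  generalize orderOf (Biquadratic.horizontalSwitch a * Biquadratic.verticalSwitch a) = n at *
  -- Order `2` is the case of determinant zero, so every other order forces the determinant not to
  -- vanish.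
  have hcrit : ∀ (m : ℕ) (p : Prop), m ≠ 2 → (a.det ≠ 0 → (n = m ↔ p)) →
      (2 * n = 2 * m ↔ a.det ≠ 0 ∧ p) := fun m p hm h => by
    constructor
    · intro hn
      have hnm : n = m := by omega
      have hdet : a.det ≠ 0 := fun h0 => hm (hnm.symm.trans (h2.2 h0))
      exact ⟨hdet, (h hdet).1 hnm⟩
    · rintro ⟨hdet, hp⟩
      rw [(h hdet).2 hp]
  refine ⟨?_, hcrit 3 _ (by norm_num) h3, hcrit 4 _ (by norm_num) h4, hcrit 5 _ (by norm_num) h5,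
    hcrit 6 _ (by norm_num) h6, ?_⟩
  · rw [← h2]
    omega
  · rintro hdet D E X S hD hE hX hS
    have hS' : S = Biquadratic.ptY a := by rw [hS, hX, Biquadratic.sqrtBranch_ptX]
    have hS2 : S ^ 2 = 4 * X ^ 3 - D * X + E := by
      rw [hS', hD, hE, hX, Biquadratic.pt_on_cubic, Biquadratic.cubic]
    exact ⟨hS2, hS', Biquadratic.taylorCoeff_formulas a (by rwa [hS']) hD
      (by linear_combination -hS2) hX hS'⟩
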